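/- **Conventions.** All $\infty$-categories are strict: they have objects and cells of every degree $n\ge 1$, with identities and strictly associative, unital composites satisfying the interchange laws. For objects $A,A'$ of $L$, the $\infty$-category with the cells of $L$ from $A$ to $A'$ is written $L(A,A')$; its cells of degree $n$ (a cell of lower degree being identified with its identities) form $L^n(A,A')$, so $L^0(A,A')$ consists of the arrows $A\to A'$. $L^{op}$ is $L$ with the direction of the arrows of degree $1$ (composition along objects) reversed. $\infty\text{-}\mathbf{CAT}$ is the $\infty$-category of small $\infty$-categories, functors, natural transformations, modifications, and so on; its cells of degree $n$ from $X$ to $Y$ are the cells of degree $n$ of the functor category $[X,Y]$. The hom-functors $L(A_0,-):L\to\infty\text{-}\mathbf{CAT}$ and $L(-,\tilde A):L^{op}\to\infty\text{-}\mathbf{CAT}$ act on cells of all degrees by composition. **Setting.** Let $\mathbb B\subset\infty\text{-}\mathbf{CAT}$ be a subcategory which contains every functor between two of its objects. Let $L,L'$ be small strict $\infty$-categories with objects $A_0,\tilde A$ of $L$ and $B_0,\tilde B$ of $L'$ such that $U=L(A_0,-)$, $V=L'(B_0,-)$, $L(-,\tilde A)$ and $L'(-,\tilde B)$ take their values in $\mathbb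 B$, and such that $U$ and $V$ are strictly faithful, that is, injective on the cells of $L(A,A')$, respectively $L'(B,B')$, for all pairs of objects. Let $\varphi:U\tilde A\to V\tilde B$ be an isomorphism of $\infty$-categories. For objects $Y,Y'$ of $L'$, a cell of degree $n$ from $VY$ to $VY'$ is called an *$L'$-arrow* if it is $V\Phi$ for some $\Phi\in L'^n(Y,Y')$; *$L$-arrows* are defined similarly. For $x\in L^n(A_0,A)$ let $ev_{A,x}=L(x,\tilde A):L(A,\tilde A)\to U\tilde A$. An *initial lift* of the $L(A,\tilde A)$ consists of an object $GA$ of $L'$ and an isomorphism $i_A:V(GA)\to L(A,\tilde A)$ for every object $A$ of $L$, such that for all $A$, all objects $Y$ of $L'$, all $n$ and all cells $f$ of degree $n$ of $\mathbb B$ from $VY$ to $L(A,\tilde A)$: $i_A^{-1}f$ is an $L'$-arrow if and only if $\varphi\, ev_{A,x} f$ is an $L'$-arrow for all $x\in L^n(A_0,A)$. $L(-,\tilde A)$ satisfies the *initial lifting condition for evaluation cones* if there is an initial lift for which moreover all $\varphi\, ev_{A,x}\, i_A$ are $L'$-arrows ($n\ge 0$, $x\in L^n(A_0,A)$). The notions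 for $L'(-,\tilde B)$ are the symmetric ones, with $\varphi^{-1}$ in place of $\varphi$. A functor $G:L^{op}\to L'$ is a *natural initial lifting* of $L(-,\tilde A)$ if there are isomorphisms $V(GA)\cong L(A,\tilde A)$, natural in $A$ (with respect to cells of all degrees), which form an initial lift; similarly for functors $F:L'^{op}\to L$ and $L'(-,\tilde B)$. **Proposition.** If $L(-,\tilde A)$ and $L'(-,\tilde B)$ satisfy the initial lifting condition for evaluation cones, then there are functors $G:L^{op}\to L'$ and $F:L'^{op}\to L$ which are natural initial liftings of $L(-,\tilde A)$ and $L'(-,\tilde B)$ (so that $V\circ G\cong L(-,\tilde A)$ and $U\circ F\cong L'(-,\tilde B)$, with schizophrenic object $(\tilde A,\tilde B)$), and which form a strict dual adjunction: there are isomorphisms of $\infty$-categories $$L(A,FB)\;\cong\;L'(B,GA)$$ natural in $A$ and $B$ with respect to cells of all degrees. **Corollary.** Any functors $G:L^{op}\to L'$ and $F:L'^{op}\to L$ which are natural initial liftings of $L(-,\tilde A)$ and $L'(-,\tilde B)$ form a strict dual adjunction. In particular, every concrete natural duality (the case in which they are moreover equivalences) is a strict adjunction. -/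

import Mathlib

universe u v w

/-- A strict `∞`-category, in the single-set presentation: one set of cells in which a cell is
identified with its identities of every higher degree.  The cells of degree `n` are the `x` with
`s n x = x`; for a cell of degree `n + 1` the domain `d` and the codomain `c` are `s n` and `t n`,
the operation `e` is the inclusion of the cells of degree `n` among those of degree `n + 1`, and
`comp n f g` is the composite of `f` after `g` along their common boundary cell of degree `n`
(so it is `f ∘ₖ g` for `f`, `g` of degree `n + k`).  Every cell has some finite degree. -/
structure OmegaCat : Type (u + 1) where
  Cell : Type u
  s : ℕ → Cell → Cell
  t : ℕ → Cell → Cell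
  comp : (n : ℕ) → (f g : Cell) → s n f = t n g → Cell
  exists_degree : ∀ x, ∃ n, s n x = x
  s_s_of_lt : ∀ {m n : ℕ}, m < n → ∀ x, s m (s n x) = s m x
  s_t_of_lt : ∀ {m n : ℕ}, m < n → ∀ x, s m (t n x) = s m x
  t_s_of_lt : ∀ {m n : ℕ}, m < n → ∀ x, t m (s n x) = t m x
  t_t_of_lt : ∀ {m n : ℕ}, m < n → ∀ x, t m (t n x) = t m x
  s_s_of_le : ∀ {m n : ℕ}, m ≤ n → ∀ x, s n (s m x) = s m x
  s_t_of_le : ∀ {m n : ℕ}, m ≤ n → ∀ x, s n (t m x) = t m x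
  t_s_of_le : ∀ {m n : ℕ}, m ≤ n → ∀ x, t n (s m x) = s m x
  t_t_of_le : ∀ {m n : ℕ}, m ≤ n → ∀ x, t n (t m x) = t m x
  s_comp : ∀ (n : ℕ) (f g : Cell) (h : s n f = t n g), s n (comp n f g h) = s n g
  t_comp : ∀ (n : ℕ) (f g : Cell) (h : s n f = t n g), t n (comp n f g h) = t n f
  s_comp_of_lt : ∀ {n m : ℕ} (hnm : n < m) (f g : Cell) (h : s n f = t n g),
    s m (comp n f g h) =
      comp n (s m f) (s m g) (by rw [s_s_of_lt hnm, t_s_of_lt hnm, h])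
  t_comp_of_lt : ∀ {n m : ℕ} (hnm : n < m) (f g : Cell) (h : s n f = t n g),
    t m (comp n f g h) =
      comp n (t m f) (t m g) (by rw [s_t_of_lt hnm, t_t_of_lt hnm, h])
  comp_s : ∀ (n : ℕ) (f : Cell), comp n f (s n f) (t_s_of_le le_rfl f).symm = f
  t_comp_self : ∀ (n : ℕ) (f : Cell), comp n (t n f) f (s_t_of_le le_rfl f) = f
  assoc : ∀ (n : ℕ) (f g k : Cell) (h₁ : s n f = t n g) (h₂ : s n g = t n k),
    comp n (comp n f g h₁) k (by rw [s_comp, h₂]) = comp n f (comp n g k h₂) (by rw [t_comp, h₁])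
  interchange : ∀ {m n : ℕ} (hmn : m < n) (f g f' g' : Cell)
    (h : s n f = t n g) (h' : s n f' = t n g') (hf : s m f = t m f') (hg : s m g = t m g'),
    comp m (comp n f g h) (comp n f' g' h')
        (by rw [← s_s_of_lt hmn (comp n f g h), s_comp, s_s_of_lt hmn, hg,
          ← t_s_of_lt hmn g', ← s_comp n f' g' h', t_s_of_lt hmn]) =
      comp n (comp m f f' hf) (comp m g g' hg)
        (by simp only [s_comp_of_lt hmn, t_comp_of_lt hmn, h, h'])

namespace OmegaCat

theorem comp_congr (X : OmegaCat.{u}) {n : ℕ} {f f' g g' : X.Cell} (hf : f = f') (hg : g = g')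
    (h : X.s n f = X.t n g) (h' : X.s n f' = X.t n g') :
    X.comp n f g h = X.comp n f' g' h' := by
  subst hf; subst hg; rfl

/-- The objects of `X`: the cells of degree `0`. -/
def Obj (X : OmegaCat.{u}) : Type u := {a : X.Cell // X.s 0 a = a}

/-- The object which is the domain of a cell in the lowest direction. -/
def src (X : OmegaCat.{u}) (f : X.Cell) : X.Obj := ⟨X.s 0 f, X.s_s_of_le le_rfl f⟩

/-- The object which is the codomain of a cell in the lowest direction. -/
def tgt (X : OmegaCat.{u}) (f : X.Cell) : X.Obj := ⟨X.t 0 f, X.s_t_of_le le_rfl f⟩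

theorem Obj.t_eq {X : OmegaCat.{u}} (a : X.Obj) : X.t 0 a.1 = a.1 := by
  rw [← a.2, X.t_s_of_le le_rfl]

theorem s_comp_lt (X : OmegaCat.{u}) {m n : ℕ} (hmn : m < n) (f g : X.Cell)
    (h : X.s n f = X.t n g) : X.s m (X.comp n f g h) = X.s m g := by
  rw [← X.s_s_of_lt hmn, X.s_comp, X.s_s_of_lt hmn]

theorem t_comp_lt (X : OmegaCat.{u}) {m n : ℕ} (hmn : m < n) (f g : X.Cell)
    (h : X.s n f = X.t n g) : X.t m (X.comp n f g h) = X.t m f := by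
  rw [← X.t_t_of_lt hmn, X.t_comp, X.t_t_of_lt hmn]

/-- The hom-set `X(a, b)`, an `∞`-category whose cells of degree `n` are the cells of `X` of
degree `n + 1` from the object `a` to the object `b`. -/
def Hom (X : OmegaCat.{u}) (a b : X.Obj) : OmegaCat.{u} where
  Cell := {f : X.Cell // X.s 0 f = a.1 ∧ X.t 0 f = b.1}
  s n f := ⟨X.s (n + 1) f.1, by
    rw [X.s_s_of_lt n.succ_pos, X.t_s_of_lt n.succ_pos]; exact f.2⟩
  t n f := ⟨X.t (n + 1) f.1, by
    rw [X.s_t_of_lt n.succ_pos, X.t_t_of_lt n.succ_pos]; exact f.2⟩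
  comp n f g h := ⟨X.comp (n + 1) f.1 g.1 (congrArg Subtype.val h), by
    rw [X.s_comp_lt n.succ_pos, X.t_comp_lt n.succ_pos]; exact ⟨g.2.1, f.2.2⟩⟩
  exists_degree f := by
    obtain ⟨n, hn⟩ := X.exists_degree f.1
    exact ⟨n, Subtype.ext (by
      change X.s (n + 1) f.1 = f.1
      rw [← hn, X.s_s_of_le n.le_succ])⟩
  s_s_of_lt h f := Subtype.ext (X.s_s_of_lt (Nat.succ_lt_succ h) f.1)
  s_t_of_lt h f := Subtype.ext (X.s_t_of_lt (Nat.succ_lt_succ h) f.1)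
  t_s_of_lt h f := Subtype.ext (X.t_s_of_lt (Nat.succ_lt_succ h) f.1)
  t_t_of_lt h f := Subtype.ext (X.t_t_of_lt (Nat.succ_lt_succ h) f.1)
  s_s_of_le h f := Subtype.ext (X.s_s_of_le (Nat.succ_le_succ h) f.1)
  s_t_of_le h f := Subtype.ext (X.s_t_of_le (Nat.succ_le_succ h) f.1)
  t_s_of_le h f := Subtype.ext (X.t_s_of_le (Nat.succ_le_succ h) f.1)
  t_t_of_le h f := Subtype.ext (X.t_t_of_le (Nat.succ_le_succ h) f.1)
  s_comp n f g _ := Subtype.ext (X.s_comp (n + 1) f.1 g.1 _)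
  t_comp n f g _ := Subtype.ext (X.t_comp (n + 1) f.1 g.1 _)
  s_comp_of_lt h f g _ := Subtype.ext (X.s_comp_of_lt (Nat.succ_lt_succ h) f.1 g.1 _)
  t_comp_of_lt h f g _ := Subtype.ext (X.t_comp_of_lt (Nat.succ_lt_succ h) f.1 g.1 _)
  comp_s n f := Subtype.ext (X.comp_s (n + 1) f.1)
  t_comp_self n f := Subtype.ext (X.t_comp_self (n + 1) f.1)
  assoc n f g k h₁ h₂ := Subtype.ext
    (X.assoc (n + 1) f.1 g.1 k.1 (congrArg Subtype.val h₁) (congrArg Subtype.val h₂))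
  interchange h f g f' g' h₁ h₂ h₃ h₄ := Subtype.ext
    (X.interchange (Nat.succ_lt_succ h) f.1 g.1 f'.1 g'.1 (congrArg Subtype.val h₁)
      (congrArg Subtype.val h₂) (congrArg Subtype.val h₃) (congrArg Subtype.val h₄))

/-- The opposite `∞`-category: only the direction of the arrows between objects is reversed. -/
def op (X : OmegaCat.{u}) : OmegaCat.{u} where
  Cell := X.Cell
  s n := match n with
    | 0 => X.t 0
    | k + 1 => X.s (k + 1)
  t n := match n with
    | 0 => X.s 0
    | k + 1 => X.t (k + 1)
  comp n := match n with
    | 0 => fun f g h => X.comp 0 g f h.symm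
    | k + 1 => fun f g h => X.comp (k + 1) f g h
  exists_degree x := by
    obtain ⟨n, hn⟩ := X.exists_degree x
    exact ⟨n + 1, by change X.s (n + 1) x = x; rw [← hn, X.s_s_of_le n.le_succ]⟩
  s_s_of_lt {m n} h x := by
    rcases n with _ | n
    · omega
    · rcases m with _ | m
      · exact X.t_s_of_lt h x
      · exact X.s_s_of_lt h x
  s_t_of_lt {m n} h x := by
    rcases n with _ | n
    · omega
    · rcases m with _ | m
      · exact X.t_t_of_lt h x
      · exact X.s_t_of_lt h x
  t_s_of_lt {m n} h x := by
    rcases n with _ | n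
    · omega
    · rcases m with _ | m
      · exact X.s_s_of_lt h x
      · exact X.t_s_of_lt h x
  t_t_of_lt {m n} h x := by
    rcases n with _ | n
    · omega
    · rcases m with _ | m
      · exact X.s_t_of_lt h x
      · exact X.t_t_of_lt h x
  s_s_of_le {m n} h x := by
    rcases m with _ | m <;> rcases n with _ | n
    · exact X.t_t_of_le h x
    · exact X.s_t_of_le h x
    · omega
    · exact X.s_s_of_le h x
  s_t_of_le {m n} h x := by
    rcases m with _ | m <;> rcases n with _ | n
    · exact X.t_s_of_le h x
    · exact X.s_s_of_le h x
    · omega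
    · exact X.s_t_of_le h x
  t_s_of_le {m n} h x := by
    rcases m with _ | m <;> rcases n with _ | n
    · exact X.s_t_of_le h x
    · exact X.t_t_of_le h x
    · omega
    · exact X.t_s_of_le h x
  t_t_of_le {m n} h x := by
    rcases m with _ | m <;> rcases n with _ | n
    · exact X.s_s_of_le h x
    · exact X.t_s_of_le h x
    · omega
    · exact X.t_t_of_le h x
  s_comp n f g h := by
    rcases n with _ | n
    · exact X.t_comp 0 g f _
    · exact X.s_comp _ f g _
  t_comp n f g h := by
    rcases n with _ | n
    · exact X.s_comp 0 g f _
    · exact X.t_comp _ f g _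
  s_comp_of_lt {n m} hnm f g h := by
    rcases m with _ | m
    · omega
    · rcases n with _ | n
      · exact X.s_comp_of_lt hnm g f _
      · exact X.s_comp_of_lt hnm f g _
  t_comp_of_lt {n m} hnm f g h := by
    rcases m with _ | m
    · omega
    · rcases n with _ | n
      · exact X.t_comp_of_lt hnm g f _
      · exact X.t_comp_of_lt hnm f g _
  comp_s n f := by
    rcases n with _ | n
    · exact X.t_comp_self 0 f
    · exact X.comp_s _ f
  t_comp_self n f := by
    rcases n with _ | n
    · exact X.comp_s 0 f
    · exact X.t_comp_self _ f
  assoc n f g k h₁ h₂ := by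
    rcases n with _ | n
    · exact (X.assoc 0 k g f h₂.symm h₁.symm).symm
    · exact X.assoc _ f g k h₁ h₂
  interchange {m n} hmn f g f' g' h h' hf hg := by
    rcases n with _ | n
    · omega
    · rcases m with _ | m
      · exact X.interchange hmn f' g' f g h' h hf.symm hg.symm
      · exact X.interchange hmn f g f' g' h h' hf hg

/-- An object of `X`, seen as an object of the opposite `∞`-category. -/
def opObj (X : OmegaCat.{u}) (a : X.Obj) : X.op.Obj := ⟨a.1, a.t_eq⟩

/-- A cell from `a` to `b`, seen as a cell from `b` to `a` of the opposite `∞`-category. -/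
def opHom (X : OmegaCat.{u}) {a b : X.Obj} (f : (X.Hom a b).Cell) :
    (X.op.Hom (X.opObj b) (X.opObj a)).Cell := ⟨f.1, f.2.2, f.2.1⟩

/-- Composition along objects, `X(b, c) × X(a, b) → X(a, c)`. -/
def homComp (X : OmegaCat.{u}) {a b c : X.Obj} (g : (X.Hom b c).Cell) (f : (X.Hom a b).Cell) :
    (X.Hom a c).Cell :=
  ⟨X.comp 0 g.1 f.1 (g.2.1.trans f.2.2.symm), by
    rw [X.s_comp, X.t_comp]; exact ⟨f.2.1, g.2.2⟩⟩

end OmegaCat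

/-- A strict `∞`-functor. -/
structure OmegaFunctor (X : OmegaCat.{u}) (Y : OmegaCat.{v}) : Type (max u v) where
  map : X.Cell → Y.Cell
  map_s : ∀ n x, map (X.s n x) = Y.s n (map x)
  map_t : ∀ n x, map (X.t n x) = Y.t n (map x)
  map_comp : ∀ n f g (h : X.s n f = X.t n g),
    map (X.comp n f g h) = Y.comp n (map f) (map g) (by rw [← map_s, ← map_t, h])

namespace OmegaFunctor

@[ext]
theorem ext {X : OmegaCat.{u}} {Y : OmegaCat.{v}} {F G : OmegaFunctor X Y}
    (h : ∀ x, F.map x = G.map x) : F = G := by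
  cases F; cases G
  congr
  exact funext h

/-- The identity functor. -/
def id (X : OmegaCat.{u}) : OmegaFunctor X X where
  map x := x
  map_s _ _ := rfl
  map_t _ _ := rfl
  map_comp _ _ _ _ := rfl

/-- The composite `G ∘ F` of functors. -/
def comp {X : OmegaCat.{u}} {Y : OmegaCat.{v}} {Z : OmegaCat.{w}}
    (G : OmegaFunctor Y Z) (F : OmegaFunctor X Y) : OmegaFunctor X Z where
  map x := G.map (F.map x)
  map_s n x := by rw [F.map_s, G.map_s]
  map_t n x := by rw [F.map_t, G.map_t]
  map_comp n f g h := by rw [F.map_comp, G.map_comp]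

/-- The action of a functor on objects. -/
def obj {X : OmegaCat.{u}} {Y : OmegaCat.{v}} (F : OmegaFunctor X Y) (a : X.Obj) : Y.Obj :=
  ⟨F.map a.1, by rw [← F.map_s, a.2]⟩

/-- The action of a functor on hom-sets, `X(a, b) → Y(F a, F b)`. -/
def mapHom {X : OmegaCat.{u}} {Y : OmegaCat.{v}} (F : OmegaFunctor X Y) {a b : X.Obj}
    (f : (X.Hom a b).Cell) : (Y.Hom (F.obj a) (F.obj b)).Cell :=
  ⟨F.map f.1, by rw [← F.map_s, f.2.1]; rfl, by rw [← F.map_t, f.2.2]; rfl⟩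

end OmegaFunctor

/-- The naturality equations `α(b) * F(f) = G(f) * α(a)`, for all cells `f` from `a` to `b`. -/
def IsNaturalFamily {X Y : OmegaCat.{u}} (F G : OmegaFunctor X Y) (α : X.Obj → Y.Cell) : Prop :=
  ∀ (f : X.Cell) (h₁ : Y.s 0 (α (X.tgt f)) = Y.t 0 (F.map f))
    (h₂ : Y.s 0 (G.map f) = Y.t 0 (α (X.src f))),
    Y.comp 0 (α (X.tgt f)) (F.map f) h₁ = Y.comp 0 (G.map f) (α (X.src f)) h₂

/-- A cell of the `∞`-category of functors from `X` to `Y`: a functor (degree `0`), a natural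
transformation (degree `1`), a modification (degree `2`), and so on.  It consists of two functors
`F`, `G` and of a cell `α(a)` of `Y` from `F(a)` to `G(a)` for every object `a`, of bounded degree,
such that `α` and all its iterated domains and codomains are natural.  A functor `F` is the cell
with `F = G` and `α(a) = F(a)`. -/
structure Transfor (X Y : OmegaCat.{u}) : Type u where
  dom : OmegaFunctor X Y
  cod : OmegaFunctor X Y
  app : X.Obj → Y.Cell
  s_app : ∀ a, Y.s 0 (app a) = dom.map a.1
  t_app : ∀ a, Y.t 0 (app a) = cod.map a.1
  exists_degree : ∃ n, ∀ a, Y.s n (app a) = app a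
  natural_s : ∀ n, IsNaturalFamily dom cod fun a => Y.s (n + 1) (app a)
  natural_t : ∀ n, IsNaturalFamily dom cod fun a => Y.t (n + 1) (app a)

namespace Transfor

@[ext]
theorem ext {X Y : OmegaCat.{u}} {α β : Transfor X Y} (h₁ : α.dom = β.dom) (h₂ : α.cod = β.cod)
    (h₃ : ∀ a, α.app a = β.app a) : α = β := by
  obtain ⟨F, G, a, _, _, _, _, _⟩ := α
  obtain ⟨F', G', b, _, _, _, _, _⟩ := β
  obtain rfl : F = F' := h₁
  obtain rfl : G = G' := h₂
  obtain rfl : a = b := funext h₃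
  rfl

theorem natural {X Y : OmegaCat.{u}} (α : Transfor X Y) :
    IsNaturalFamily α.dom α.cod α.app := by
  obtain ⟨n, hn⟩ := α.exists_degree
  have h : (fun a => Y.s (n + 1) (α.app a)) = α.app := funext fun a => by
    rw [← hn a, Y.s_s_of_le n.le_succ]
  have := α.natural_s n
  rwa [h] at this

theorem natural_id {X Y : OmegaCat.{u}} (F : OmegaFunctor X Y) :
    IsNaturalFamily F F fun a => F.map a.1 := by
  intro f h₁ h₂
  have e₁ : F.map (X.tgt f).1 = Y.t 0 (F.map f) := F.map_t 0 f
  have e₂ : F.map (X.src f).1 = Y.s 0 (F.map f) := F.map_s 0 f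
  rw [Y.comp_congr e₁ rfl h₁ (Y.s_t_of_le le_rfl _), Y.t_comp_self,
    Y.comp_congr rfl e₂ h₂ (Y.t_s_of_le le_rfl _).symm, Y.comp_s]

theorem natural_comp_zero {X Y : OmegaCat.{u}} {F G H : OmegaFunctor X Y} {α β : X.Obj → Y.Cell}
    (hα : IsNaturalFamily G H α) (hβ : IsNaturalFamily F G β)
    (sα : ∀ a, Y.s 0 (α a) = G.map a.1) (tα : ∀ a, Y.t 0 (α a) = H.map a.1)
    (sβ : ∀ a, Y.s 0 (β a) = F.map a.1) (tβ : ∀ a, Y.t 0 (β a) = G.map a.1) :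
    IsNaturalFamily F H fun a => Y.comp 0 (α a) (β a) ((sα a).trans (tβ a).symm) := by
  intro f h₁ h₂
  have sF : F.map (X.tgt f).1 = Y.t 0 (F.map f) := F.map_t 0 f
  have sG : G.map (X.tgt f).1 = Y.t 0 (G.map f) := G.map_t 0 f
  have tG : G.map (X.src f).1 = Y.s 0 (G.map f) := G.map_s 0 f
  have tH : H.map (X.src f).1 = Y.s 0 (H.map f) := H.map_s 0 f
  rw [Y.assoc 0 _ _ _ _ ((sβ _).trans sF), ← Y.assoc 0 _ _ _ (tH.symm.trans (tα _).symm)]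
  rw [Y.comp_congr rfl (hβ f ((sβ _).trans sF) (tG.symm.trans (tβ _).symm)) _
    (by rw [Y.t_comp, sα, sG])]
  rw [Y.comp_congr (hα f ((sα _).trans sG) (tH.symm.trans (tα _).symm)).symm rfl _
    (by rw [Y.s_comp, ← tG, tβ])]
  rw [Y.assoc]

theorem natural_comp_succ {X Y : OmegaCat.{u}} {F G : OmegaFunctor X Y} {α β : X.Obj → Y.Cell}
    (hα : IsNaturalFamily F G α) (hβ : IsNaturalFamily F G β)
    (sα : ∀ a, Y.s 0 (α a) = F.map a.1) (tα : ∀ a, Y.t 0 (α a) = G.map a.1)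
    (sβ : ∀ a, Y.s 0 (β a) = F.map a.1) (tβ : ∀ a, Y.t 0 (β a) = G.map a.1)
    (n : ℕ) (h : ∀ a, Y.s (n + 1) (α a) = Y.t (n + 1) (β a)) :
    IsNaturalFamily F G fun a => Y.comp (n + 1) (α a) (β a) (h a) := by
  intro f h₁ h₂
  have sF : F.map (X.tgt f).1 = Y.t 0 (F.map f) := F.map_t 0 f
  have tG : G.map (X.src f).1 = Y.s 0 (G.map f) := G.map_s 0 f
  have p := n.succ_pos
  have eF : F.map f = Y.comp (n + 1) (F.map f) (Y.s (n + 1) (F.map f))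
    (Y.t_s_of_le le_rfl _).symm := (Y.comp_s _ _).symm
  have eG : G.map f = Y.comp (n + 1) (G.map f) (Y.s (n + 1) (G.map f))
    (Y.t_s_of_le le_rfl _).symm := (Y.comp_s _ _).symm
  have ht : X.tgt (X.s (n + 1) f) = X.tgt f := Subtype.ext (X.t_s_of_lt p f)
  have hs : X.src (X.s (n + 1) f) = X.src f := Subtype.ext (X.s_s_of_lt p f)
  have nα := hα f ((sα _).trans sF) (tG.symm.trans (tα _).symm)
  have nβ := hβ (X.s (n + 1) f)
    (by rw [ht, sβ, F.map_s, Y.t_s_of_lt p, sF])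
    (by rw [hs, tβ, G.map_s, Y.s_s_of_lt p, tG])
  have nβ' : Y.comp 0 (β (X.tgt f)) (Y.s (n + 1) (F.map f)) (by
        rw [sβ, Y.t_s_of_lt p, sF]) =
      Y.comp 0 (Y.s (n + 1) (G.map f)) (β (X.src f)) (by
        rw [tβ, Y.s_s_of_lt p, tG]) := by
    rw [Y.comp_congr (congrArg β ht.symm) (F.map_s (n + 1) f).symm _
      (by rw [ht, sβ, F.map_s, Y.t_s_of_lt p, sF]), nβ]
    exact Y.comp_congr (G.map_s _ f) (congrArg β hs) _ _
  rw [Y.comp_congr rfl eF _ (by rw [Y.t_comp_lt p, Y.s_comp_lt p, sβ, sF]),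
    Y.comp_congr eG rfl _ (by rw [Y.t_comp_lt p, Y.s_comp_lt p, tα, Y.s_s_of_lt p, tG])]
  rw [Y.interchange p _ _ _ _ _ _ ((sα _).trans sF) (by rw [sβ, Y.t_s_of_lt p, sF]),
    Y.interchange p _ _ _ _ _ _ (by rw [tα, tG]) (by rw [tβ, Y.s_s_of_lt p, tG])]
  exact Y.comp_congr nα nβ' _ _

theorem natural_pre {X Y Z : OmegaCat.{u}} {F G : OmegaFunctor Y Z} {α : Y.Obj → Z.Cell}
    (hα : IsNaturalFamily F G α) (H : OmegaFunctor X Y) :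
    IsNaturalFamily (F.comp H) (G.comp H) fun a => α (H.obj a) := by
  intro f h₁ h₂
  have e₁ : H.obj (X.tgt f) = Y.tgt (H.map f) := Subtype.ext (H.map_t 0 f)
  have e₂ : H.obj (X.src f) = Y.src (H.map f) := Subtype.ext (H.map_s 0 f)
  have := hα (H.map f) (by rw [← e₁]; exact h₁) (by rw [← e₂]; exact h₂)
  simp only [← e₁, ← e₂] at this
  exact this

theorem natural_post {X Y Z : OmegaCat.{u}} {F G : OmegaFunctor X Y} {α : X.Obj → Y.Cell}
    (hα : IsNaturalFamily F G α) (H : OmegaFunctor Y Z)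
    (sα : ∀ a, Y.s 0 (α a) = F.map a.1) (tα : ∀ a, Y.t 0 (α a) = G.map a.1) :
    IsNaturalFamily (H.comp F) (H.comp G) fun a => H.map (α a) := by
  intro f h₁ h₂
  have := congrArg H.map (hα f ((sα (X.tgt f)).trans (F.map_t 0 f))
    ((G.map_s 0 f).symm.trans (tα (X.src f)).symm))
  rwa [H.map_comp, H.map_comp] at this

theorem s_ofFunctor_app {X Y : OmegaCat.{u}} (F : OmegaFunctor X Y) (a : X.Obj) (n : ℕ) :
    Y.s (n + 1) (F.map a.1) = F.map a.1 := by
  rw [← F.map_s, ← a.2, X.s_s_of_le (Nat.zero_le _)]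

theorem t_ofFunctor_app {X Y : OmegaCat.{u}} (F : OmegaFunctor X Y) (a : X.Obj) (n : ℕ) :
    Y.t (n + 1) (F.map a.1) = F.map a.1 := by
  rw [← F.map_t, ← a.2, X.t_s_of_le (Nat.zero_le _)]

/-- A functor as a cell of degree `0`. -/
def ofFunctor {X Y : OmegaCat.{u}} (F : OmegaFunctor X Y) : Transfor X Y where
  dom := F
  cod := F
  app a := F.map a.1
  s_app a := by rw [← F.map_s, a.2]
  t_app a := by rw [← F.map_t, a.t_eq]
  exists_degree := ⟨0, fun a => by rw [← F.map_s, a.2]⟩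
  natural_s n := by
    have h : (fun a : X.Obj => Y.s (n + 1) (F.map a.1)) = fun a => F.map a.1 := funext fun a => by
      rw [← F.map_s, ← a.2, X.s_s_of_le (Nat.zero_le _)]
    rw [h]; exact natural_id F
  natural_t n := by
    have h : (fun a : X.Obj => Y.t (n + 1) (F.map a.1)) = fun a => F.map a.1 := funext fun a => by
      rw [← F.map_t, ← a.2, X.t_s_of_le (Nat.zero_le _)]
    rw [h]; exact natural_id F

/-- The domain of degree `n`; for `n = 0` it is the domain functor, in positive degree it is taken
componentwise. -/
def s {X Y : OmegaCat.{u}} (n : ℕ) (α : Transfor X Y) : Transfor X Y :=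
  match n with
  | 0 => ofFunctor α.dom
  | k + 1 =>
    { dom := α.dom
      cod := α.cod
      app := fun a => Y.s (k + 1) (α.app a)
      s_app := fun a => by rw [Y.s_s_of_lt k.succ_pos, α.s_app]
      t_app := fun a => by rw [Y.t_s_of_lt k.succ_pos, α.t_app]
      exists_degree := ⟨k + 1, fun a => Y.s_s_of_le le_rfl _⟩
      natural_s := fun n => by
        rcases lt_or_ge n k with h | h
        · simpa only [Y.s_s_of_lt (Nat.succ_lt_succ h)] using α.natural_s n
        · simpa only [Y.s_s_of_le (Nat.succ_le_succ h)] using α.natural_s k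
      natural_t := fun n => by
        rcases lt_or_ge n k with h | h
        · simpa only [Y.t_s_of_lt (Nat.succ_lt_succ h)] using α.natural_t n
        · simpa only [Y.t_s_of_le (Nat.succ_le_succ h)] using α.natural_s k }

/-- The codomain of degree `n`. -/
def t {X Y : OmegaCat.{u}} (n : ℕ) (α : Transfor X Y) : Transfor X Y :=
  match n with
  | 0 => ofFunctor α.cod
  | k + 1 =>
    { dom := α.dom
      cod := α.cod
      app := fun a => Y.t (k + 1) (α.app a)
      s_app := fun a => by rw [Y.s_t_of_lt k.succ_pos, α.s_app]
      t_app := fun a => by rw [Y.t_t_of_lt k.succ_pos, α.t_app]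
      exists_degree := ⟨k + 1, fun a => Y.s_t_of_le le_rfl _⟩
      natural_s := fun n => by
        rcases lt_or_ge n k with h | h
        · simpa only [Y.s_t_of_lt (Nat.succ_lt_succ h)] using α.natural_s n
        · simpa only [Y.s_t_of_le (Nat.succ_le_succ h)] using α.natural_t k
      natural_t := fun n => by
        rcases lt_or_ge n k with h | h
        · simpa only [Y.t_t_of_lt (Nat.succ_lt_succ h)] using α.natural_t n
        · simpa only [Y.t_t_of_le (Nat.succ_le_succ h)] using α.natural_t k }

theorem cod_eq_dom {X Y : OmegaCat.{u}} {α β : Transfor X Y} (h : s 0 α = t 0 β) :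
    α.dom = β.cod := congrArg dom h

theorem dom_eq {X Y : OmegaCat.{u}} {n : ℕ} {α β : Transfor X Y} (h : s (n + 1) α = t (n + 1) β) :
    α.dom = β.dom := by
  have : (s (n + 1) α).dom = (t (n + 1) β).dom := by rw [h]
  exact this

theorem cod_eq {X Y : OmegaCat.{u}} {n : ℕ} {α β : Transfor X Y} (h : s (n + 1) α = t (n + 1) β) :
    α.cod = β.cod := by
  have : (s (n + 1) α).cod = (t (n + 1) β).cod := by rw [h]
  exact this

theorem app_eq {X Y : OmegaCat.{u}} {n : ℕ} {α β : Transfor X Y} (h : s (n + 1) α = t (n + 1) β)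
    (a : X.Obj) : Y.s (n + 1) (α.app a) = Y.t (n + 1) (β.app a) :=
  congrFun (congrArg app h) a

/-- The composite of `α` after `β` along their common boundary of degree `n`, taken
componentwise. -/
def comp {X Y : OmegaCat.{u}} (n : ℕ) (α β : Transfor X Y) (h : s n α = t n β) : Transfor X Y :=
  match n, h with
  | 0, h =>
    have e : ∀ a, Y.s 0 (α.app a) = Y.t 0 (β.app a) := fun a => by
      rw [α.s_app, β.t_app, cod_eq_dom h]
    { dom := β.dom
      cod := α.cod
      app := fun a => Y.comp 0 (α.app a) (β.app a) (e a)
      s_app := fun a => by rw [Y.s_comp, β.s_app]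
      t_app := fun a => by rw [Y.t_comp, α.t_app]
      exists_degree := by
        obtain ⟨m, hm⟩ := α.exists_degree
        obtain ⟨k, hk⟩ := β.exists_degree
        refine ⟨m + k + 1, fun a => ?_⟩
        rw [Y.s_comp_of_lt (Nat.succ_pos _)]
        apply Y.comp_congr
        · rw [← hm a, Y.s_s_of_le (by omega)]
        · rw [← hk a, Y.s_s_of_le (by omega)]
      natural_s := fun m => by
        have hd := cod_eq_dom h
        have p := m.succ_pos
        simp only [Y.s_comp_of_lt p]
        exact natural_comp_zero (hd ▸ α.natural_s m) (β.natural_s m)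
          (fun a => by rw [Y.s_s_of_lt p, α.s_app, hd])
          (fun a => by rw [Y.t_s_of_lt p, α.t_app])
          (fun a => by rw [Y.s_s_of_lt p, β.s_app])
          (fun a => by rw [Y.t_s_of_lt p, β.t_app])
      natural_t := fun m => by
        have hd := cod_eq_dom h
        have p := m.succ_pos
        simp only [Y.t_comp_of_lt p]
        exact natural_comp_zero (hd ▸ α.natural_t m) (β.natural_t m)
          (fun a => by rw [Y.s_t_of_lt p, α.s_app, hd])
          (fun a => by rw [Y.t_t_of_lt p, α.t_app])
          (fun a => by rw [Y.s_t_of_lt p, β.s_app])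
          (fun a => by rw [Y.t_t_of_lt p, β.t_app]) }
  | k + 1, h =>
    { dom := β.dom
      cod := α.cod
      app := fun a => Y.comp (k + 1) (α.app a) (β.app a) (app_eq h a)
      s_app := fun a => by rw [Y.s_comp_lt k.succ_pos, β.s_app]
      t_app := fun a => by rw [Y.t_comp_lt k.succ_pos, α.t_app]
      exists_degree := by
        obtain ⟨m, hm⟩ := α.exists_degree
        obtain ⟨l, hl⟩ := β.exists_degree
        refine ⟨m + l + k + 2, fun a => ?_⟩
        rw [Y.s_comp_of_lt (by omega)]
        apply Y.comp_congr
        · rw [← hm a, Y.s_s_of_le (by omega)]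
        · rw [← hl a, Y.s_s_of_le (by omega)]
      natural_s := fun m => by
        have hd := dom_eq h
        have hc := cod_eq h
        rcases lt_trichotomy m k with hm | rfl | hm
        · simpa only [Y.s_comp_lt (Nat.succ_lt_succ hm), hc] using β.natural_s m
        · simpa only [Y.s_comp, hc] using β.natural_s m
        · have p := m.succ_pos
          simp only [Y.s_comp_of_lt (Nat.succ_lt_succ hm)]
          exact natural_comp_succ (hd ▸ α.natural_s m) (hc ▸ β.natural_s m)
            (fun a => by rw [Y.s_s_of_lt p, α.s_app, hd])
            (fun a => by rw [Y.t_s_of_lt p, α.t_app])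
            (fun a => by rw [Y.s_s_of_lt p, β.s_app])
            (fun a => by rw [Y.t_s_of_lt p, β.t_app, hc]) k _
      natural_t := fun m => by
        have hd := dom_eq h
        have hc := cod_eq h
        rcases lt_trichotomy m k with hm | rfl | hm
        · simpa only [Y.t_comp_lt (Nat.succ_lt_succ hm), hd] using α.natural_t m
        · simpa only [Y.t_comp, hd] using α.natural_t m
        · have p := m.succ_pos
          simp only [Y.t_comp_of_lt (Nat.succ_lt_succ hm)]
          exact natural_comp_succ (hd ▸ α.natural_t m) (hc ▸ β.natural_t m)
            (fun a => by rw [Y.s_t_of_lt p, α.s_app, hd])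
            (fun a => by rw [Y.t_t_of_lt p, α.t_app])
            (fun a => by rw [Y.s_t_of_lt p, β.s_app])
            (fun a => by rw [Y.t_t_of_lt p, β.t_app, hc]) k _ }

/-- Horizontal composition `[Y, Z] × [X, Y] → [X, Z]`, with components
`β(G a) ∘ F'(α(a))` for `α : F → G` and `β : F' → G'`. -/
def hcomp {X Y Z : OmegaCat.{u}} (β : Transfor Y Z) (α : Transfor X Y) : Transfor X Z where
  dom := β.dom.comp α.dom
  cod := β.cod.comp α.cod
  app a := Z.comp 0 (β.app (α.cod.obj a)) (β.dom.map (α.app a))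
    (by rw [β.s_app, ← β.dom.map_t, α.t_app]; rfl)
  s_app a := by rw [Z.s_comp, ← β.dom.map_s, α.s_app]; rfl
  t_app a := by rw [Z.t_comp, β.t_app]; rfl
  exists_degree := by
    obtain ⟨m, hm⟩ := β.exists_degree
    obtain ⟨k, hk⟩ := α.exists_degree
    refine ⟨m + k + 1, fun a => ?_⟩
    rw [Z.s_comp_of_lt (Nat.succ_pos _)]
    apply Z.comp_congr
    · rw [← hm, Z.s_s_of_le (by omega)]
    · rw [← hk a, β.dom.map_s, Z.s_s_of_le (by omega)]
  natural_s n := by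
    have p := n.succ_pos
    simp only [Z.s_comp_of_lt p]
    refine natural_comp_zero (G := β.dom.comp α.cod) (α := fun a => Z.s (n + 1) (β.app (α.cod.obj a)))
      (β := fun a => Z.s (n + 1) (β.dom.map (α.app a))) ?_ ?_
      (fun a => by rw [Z.s_s_of_lt p, β.s_app]; rfl)
      (fun a => by rw [Z.t_s_of_lt p, β.t_app]; rfl)
      (fun a => by rw [Z.s_s_of_lt p, ← β.dom.map_s, α.s_app]; rfl)
      (fun a => by rw [Z.t_s_of_lt p, ← β.dom.map_t, α.t_app]; rfl)
    · exact natural_pre (β.natural_s n) α.cod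
    · simpa only [β.dom.map_s] using natural_post (α.natural_s n) β.dom
        (fun a => by rw [Y.s_s_of_lt p, α.s_app])
        (fun a => by rw [Y.t_s_of_lt p, α.t_app])
  natural_t n := by
    have p := n.succ_pos
    simp only [Z.t_comp_of_lt p]
    refine natural_comp_zero (G := β.dom.comp α.cod) (α := fun a => Z.t (n + 1) (β.app (α.cod.obj a)))
      (β := fun a => Z.t (n + 1) (β.dom.map (α.app a))) ?_ ?_
      (fun a => by rw [Z.s_t_of_lt p, β.s_app]; rfl)
      (fun a => by rw [Z.t_t_of_lt p, β.t_app]; rfl)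
      (fun a => by rw [Z.s_t_of_lt p, ← β.dom.map_s, α.s_app]; rfl)
      (fun a => by rw [Z.t_t_of_lt p, ← β.dom.map_t, α.t_app]; rfl)
    · exact natural_pre (β.natural_t n) α.cod
    · simpa only [β.dom.map_t] using natural_post (α.natural_t n) β.dom
        (fun a => by rw [Y.s_t_of_lt p, α.s_app])
        (fun a => by rw [Y.t_t_of_lt p, α.t_app])

/-- The whiskered form of horizontal composition agrees with the one in the other order. -/
theorem hcomp_app' {X Y Z : OmegaCat.{u}} (β : Transfor Y Z) (α : Transfor X Y) (a : X.Obj)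
    (h : Z.s 0 (β.cod.map (α.app a)) = Z.t 0 (β.app (α.dom.obj a))) :
    (hcomp β α).app a = Z.comp 0 (β.cod.map (α.app a)) (β.app (α.dom.obj a)) h := by
  have e₁ : Y.tgt (α.app a) = α.cod.obj a := Subtype.ext (α.t_app a)
  have e₂ : Y.src (α.app a) = α.dom.obj a := Subtype.ext (α.s_app a)
  have := β.natural (α.app a) (by rw [e₁, β.s_app, ← β.dom.map_t, α.t_app]; rfl) (by rw [e₂, h])
  simp only [e₁, e₂] at this
  exact this

end Transfor

/-- The `∞`-category `[X, Y]` of functors from `X` to `Y`, natural transformations,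
modifications, and so on. -/
def functorCat (X Y : OmegaCat.{u}) : OmegaCat.{u} where
  Cell := Transfor X Y
  s := Transfor.s
  t := Transfor.t
  comp := Transfor.comp
  exists_degree α := by
    obtain ⟨n, hn⟩ := α.exists_degree
    refine ⟨n + 1, Transfor.ext rfl rfl fun a => ?_⟩
    change Y.s (n + 1) (α.app a) = α.app a
    rw [← hn a, Y.s_s_of_le n.le_succ]
  s_s_of_lt {m n} h x := by
    rcases n with _ | n
    · omega
    · rcases m with _ | m
      · rfl
      · exact Transfor.ext rfl rfl fun a => Y.s_s_of_lt h _
  s_t_of_lt {m n} h x := by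
    rcases n with _ | n
    · omega
    · rcases m with _ | m
      · rfl
      · exact Transfor.ext rfl rfl fun a => Y.s_t_of_lt h _
  t_s_of_lt {m n} h x := by
    rcases n with _ | n
    · omega
    · rcases m with _ | m
      · rfl
      · exact Transfor.ext rfl rfl fun a => Y.t_s_of_lt h _
  t_t_of_lt {m n} h x := by
    rcases n with _ | n
    · omega
    · rcases m with _ | m
      · rfl
      · exact Transfor.ext rfl rfl fun a => Y.t_t_of_lt h _
  s_s_of_le {m n} h x := by
    rcases m with _ | m <;> rcases n with _ | n
    · rfl
    · exact Transfor.ext rfl rfl fun a => Transfor.s_ofFunctor_app x.dom a n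
    · omega
    · exact Transfor.ext rfl rfl fun a => Y.s_s_of_le h _
  s_t_of_le {m n} h x := by
    rcases m with _ | m <;> rcases n with _ | n
    · rfl
    · exact Transfor.ext rfl rfl fun a => Transfor.s_ofFunctor_app x.cod a n
    · omega
    · exact Transfor.ext rfl rfl fun a => Y.s_t_of_le h _
  t_s_of_le {m n} h x := by
    rcases m with _ | m <;> rcases n with _ | n
    · rfl
    · exact Transfor.ext rfl rfl fun a => Transfor.t_ofFunctor_app x.dom a n
    · omega
    · exact Transfor.ext rfl rfl fun a => Y.t_s_of_le h _
  t_t_of_le {m n} h x := by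
    rcases m with _ | m <;> rcases n with _ | n
    · rfl
    · exact Transfor.ext rfl rfl fun a => Transfor.t_ofFunctor_app x.cod a n
    · omega
    · exact Transfor.ext rfl rfl fun a => Y.t_t_of_le h _
  s_comp n f g h := by
    rcases n with _ | n
    · rfl
    · have e : f.cod = g.cod := Transfor.cod_eq h
      exact Transfor.ext rfl e fun a => Y.s_comp _ _ _ _
  t_comp n f g h := by
    rcases n with _ | n
    · rfl
    · have e : g.dom = f.dom := (Transfor.dom_eq h).symm
      exact Transfor.ext e rfl fun a => Y.t_comp _ _ _ _
  s_comp_of_lt {n m} hnm f g h := by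
    rcases m with _ | m
    · omega
    · rcases n with _ | n
      · exact Transfor.ext rfl rfl fun a => Y.s_comp_of_lt hnm _ _ _
      · exact Transfor.ext rfl rfl fun a => Y.s_comp_of_lt hnm _ _ _
  t_comp_of_lt {n m} hnm f g h := by
    rcases m with _ | m
    · omega
    · rcases n with _ | n
      · exact Transfor.ext rfl rfl fun a => Y.t_comp_of_lt hnm _ _ _
      · exact Transfor.ext rfl rfl fun a => Y.t_comp_of_lt hnm _ _ _
  comp_s n f := by
    rcases n with _ | n
    · exact Transfor.ext rfl rfl fun a =>
        (Y.comp_congr rfl (f.s_app a).symm _ _).trans (Y.comp_s 0 _)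
    · exact Transfor.ext rfl rfl fun a => Y.comp_s _ _
  t_comp_self n f := by
    rcases n with _ | n
    · exact Transfor.ext rfl rfl fun a =>
        (Y.comp_congr (f.t_app a).symm rfl _ _).trans (Y.t_comp_self 0 _)
    · exact Transfor.ext rfl rfl fun a => Y.t_comp_self _ _
  assoc n f g k h₁ h₂ := by
    rcases n with _ | n
    · exact Transfor.ext rfl rfl fun a => Y.assoc _ _ _ _ _ _
    · exact Transfor.ext rfl rfl fun a => Y.assoc _ _ _ _ _ _
  interchange {m n} hmn f g f' g' h h' hf hg := by
    rcases n with _ | n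
    · omega
    · rcases m with _ | m
      · exact Transfor.ext rfl rfl fun a => Y.interchange hmn _ _ _ _ _ _ _ _
      · exact Transfor.ext rfl rfl fun a => Y.interchange hmn _ _ _ _ _ _ _ _

namespace Transfor

theorem hcomp_id {X Y : OmegaCat.{u}} (α : Transfor X Y) :
    hcomp α (ofFunctor (OmegaFunctor.id X)) = α := by
  refine Transfor.ext rfl rfl fun a => ?_
  have e : α.dom.map a.1 = Y.s 0 (α.app a) := (α.s_app a).symm
  exact (Y.comp_congr rfl e _ (Y.t_s_of_le le_rfl _).symm).trans (Y.comp_s 0 _)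

theorem id_hcomp {X Y : OmegaCat.{u}} (α : Transfor X Y) :
    hcomp (ofFunctor (OmegaFunctor.id Y)) α = α := by
  refine Transfor.ext rfl rfl fun a => ?_
  have e : α.cod.map a.1 = Y.t 0 (α.app a) := (α.t_app a).symm
  exact (Y.comp_congr e rfl _ (Y.s_t_of_le le_rfl _)).trans (Y.t_comp_self 0 _)

theorem hcomp_assoc {X Y Z W : OmegaCat.{u}} (γ : Transfor Z W) (β : Transfor Y Z)
    (α : Transfor X Y) : hcomp (hcomp γ β) α = hcomp γ (hcomp β α) := by
  refine Transfor.ext rfl rfl fun a => ?_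
  refine (W.assoc 0 _ _ _ _ ?_).trans (W.comp_congr rfl ?_ _ _)
  · rw [← γ.dom.map_s, β.s_app]
    change _ = W.t 0 (γ.dom.map (β.dom.map (α.app a)))
    rw [← γ.dom.map_t, ← β.dom.map_t, α.t_app]
    rfl
  · exact (γ.dom.map_comp 0 _ _ _).symm

theorem s_hcomp {X Y Z : OmegaCat.{u}} (n : ℕ) (β : Transfor Y Z) (α : Transfor X Y) :
    s n (hcomp β α) = hcomp (s n β) (s n α) := by
  rcases n with _ | n
  · refine Transfor.ext rfl rfl fun a => ?_
    have e : β.dom.map (α.dom.map a.1) = Z.t 0 (β.dom.map (α.dom.map a.1)) := by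
      rw [← β.dom.map_t, ← α.dom.map_t, a.t_eq]
    exact ((Z.comp_congr e rfl _ (Z.s_t_of_le le_rfl _)).trans (Z.t_comp_self 0 _)).symm
  · refine Transfor.ext rfl rfl fun a => ?_
    refine (Z.s_comp_of_lt n.succ_pos _ _ _).trans (Z.comp_congr rfl ?_ _ _)
    exact (β.dom.map_s _ _).symm

theorem t_hcomp {X Y Z : OmegaCat.{u}} (n : ℕ) (β : Transfor Y Z) (α : Transfor X Y) :
    t n (hcomp β α) = hcomp (t n β) (t n α) := by
  rcases n with _ | n
  · refine Transfor.ext rfl rfl fun a => ?_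
    have e : β.cod.map (α.cod.map a.1) = Z.t 0 (β.cod.map (α.cod.map a.1)) := by
      rw [← β.cod.map_t, ← α.cod.map_t, a.t_eq]
    exact ((Z.comp_congr e rfl _ (Z.s_t_of_le le_rfl _)).trans (Z.t_comp_self 0 _)).symm
  · refine Transfor.ext rfl rfl fun a => ?_
    refine (Z.t_comp_of_lt n.succ_pos _ _ _).trans (Z.comp_congr rfl ?_ _ _)
    exact (β.dom.map_t _ _).symm

theorem four_comp (Z : OmegaCat.{u}) {p q r k l m : Z.Cell} (h₁ : Z.s 0 p = Z.t 0 q)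
    (h₂ : Z.s 0 q = Z.t 0 r) (h₃ : Z.s 0 r = Z.t 0 k) (h₄ : Z.s 0 l = Z.t 0 m)
    (h₅ : Z.s 0 p = Z.t 0 l) (h₆ : Z.s 0 m = Z.t 0 k)
    (e : Z.comp 0 q r h₂ = Z.comp 0 l m h₄)
    (h₇ : Z.s 0 (Z.comp 0 p q h₁) = Z.t 0 (Z.comp 0 r k h₃))
    (h₈ : Z.s 0 (Z.comp 0 p l h₅) = Z.t 0 (Z.comp 0 m k h₆)) :
    Z.comp 0 (Z.comp 0 p q h₁) (Z.comp 0 r k h₃) h₇ =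
      Z.comp 0 (Z.comp 0 p l h₅) (Z.comp 0 m k h₆) h₈ := by
  rw [Z.assoc 0 _ _ _ h₁ (by rw [Z.t_comp, h₂]), Z.assoc 0 _ _ _ h₅ (by rw [Z.t_comp, h₄])]
  refine Z.comp_congr rfl ?_ _ _
  rw [← Z.assoc 0 _ _ _ h₂ h₃, ← Z.assoc 0 _ _ _ h₄ h₆]
  exact Z.comp_congr e rfl _ _

theorem hcomp_comp {X Y Z : OmegaCat.{u}} (n : ℕ) (β β' : Transfor Y Z) (α α' : Transfor X Y)
    (h : s n β = t n β') (h' : s n α = t n α')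
    (h'' : s n (hcomp β α) = t n (hcomp β' α')) :
    hcomp (comp n β β' h) (comp n α α' h') = comp n (hcomp β α) (hcomp β' α') h'' := by
  rcases n with _ | n
  · have hd : α.dom = α'.cod := cod_eq_dom h'
    have kd : β.dom = β'.cod := cod_eq_dom h
    refine Transfor.ext rfl rfl fun x => ?_
    have e₁ : Z.s 0 (β.app (α.cod.obj x)) = Z.t 0 (β'.app (α.cod.obj x)) := by
      rw [β.s_app, β'.t_app, kd]
    have e₂ : Z.s 0 (β'.app (α.cod.obj x)) = Z.t 0 (β'.dom.map (α.app x)) := by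
      rw [β'.s_app, ← β'.dom.map_t, α.t_app]; rfl
    have e₃ : Z.s 0 (β'.dom.map (α.app x)) = Z.t 0 (β'.dom.map (α'.app x)) := by
      rw [← β'.dom.map_s, ← β'.dom.map_t, α.s_app, α'.t_app, hd]
    have e₄ : Z.s 0 (β.dom.map (α.app x)) = Z.t 0 (β'.app (α'.cod.obj x)) := by
      rw [← β.dom.map_s, α.s_app, β'.t_app, kd, hd]; rfl
    have e₅ : Z.s 0 (β.app (α.cod.obj x)) = Z.t 0 (β.dom.map (α.app x)) := by
      rw [β.s_app, ← β.dom.map_t, α.t_app]; rfl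
    have e₆ : Z.s 0 (β'.app (α'.cod.obj x)) = Z.t 0 (β'.dom.map (α'.app x)) := by
      rw [β'.s_app, ← β'.dom.map_t, α'.t_app]; rfl
    have hx : α.dom.obj x = α'.cod.obj x := by rw [hd]
    have key : Z.comp 0 (β'.app (α.cod.obj x)) (β'.dom.map (α.app x)) e₂ =
        Z.comp 0 (β.dom.map (α.app x)) (β'.app (α'.cod.obj x)) e₄ :=
      (hcomp_app' β' α x (by rw [← kd, hx, e₄])).trans
        (Z.comp_congr (by rw [kd]) (by rw [hx]) _ _)
    refine (Z.comp_congr rfl (β'.dom.map_comp 0 (α.app x) (α'.app x) _) _ ?_).trans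
      (four_comp Z e₁ e₂ e₃ e₄ e₅ e₆ key ?_ ?_)
    · exact (Z.s_comp 0 _ _ e₁).trans (e₂.trans (Z.t_comp 0 _ _ e₃).symm)
    · rw [Z.s_comp, Z.t_comp, e₂]
    · rw [Z.s_comp, Z.t_comp, e₄]
  · have hd : α.dom = α'.dom := dom_eq h'
    have hc : α.cod = α'.cod := cod_eq h'
    have kd : β.dom = β'.dom := dom_eq h
    have p := n.succ_pos
    refine Transfor.ext rfl rfl fun x => ?_
    have ea := app_eq h' x
    have eb := app_eq h (α.cod.obj x)
    have hx : α.cod.obj x = α'.cod.obj x := by rw [hc]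
    have e₁ : Z.s (n + 1) (β.dom.map (α.app x)) = Z.t (n + 1) (β'.dom.map (α'.app x)) := by
      rw [← β.dom.map_s, ← β'.dom.map_t, ea, kd]
    have e₂ : Z.s 0 (β.app (α.cod.obj x)) = Z.t 0 (β.dom.map (α.app x)) := by
      rw [β.s_app, ← β.dom.map_t, α.t_app]; rfl
    have e₃ : Z.s 0 (β'.app (α'.cod.obj x)) = Z.t 0 (β'.dom.map (α'.app x)) := by
      rw [β'.s_app, ← β'.dom.map_t, α'.t_app]; rfl
    have e₄ : Z.s 0 (β'.app (α.cod.obj x)) = Z.t 0 (β'.dom.map (α'.app x)) := by rw [hx, e₃]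
    have c : β'.dom.map (Y.comp (n + 1) (α.app x) (α'.app x) ea) =
        Z.comp (n + 1) (β.dom.map (α.app x)) (β'.dom.map (α'.app x)) e₁ := by
      rw [β'.dom.map_comp]
      exact Z.comp_congr (by rw [kd]) rfl _ _
    refine (Z.comp_congr rfl c _ ?_).trans ((Z.interchange p _ _ _ _ eb e₁ e₂ e₄).trans
      (Z.comp_congr rfl (Z.comp_congr (by rw [hx]) rfl _ _) _ _))
    rw [Z.t_comp_lt p, ← e₂]
    exact (Z.s_comp_lt p _ _ eb).trans (by rw [β.s_app, β'.s_app, kd])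

end Transfor

/-- A cell of `∞-CAT`: two `∞`-categories and a cell of the functor category between them. An
`∞`-category is identified with its identity functor. -/
structure CatCell : Type (u + 1) where
  dom : OmegaCat.{u}
  cod : OmegaCat.{u}
  arr : Transfor dom cod

namespace CatCell

/-- An `∞`-category as a cell of degree `0`: its identity functor. -/
def ofCat (X : OmegaCat.{u}) : CatCell.{u} := ⟨X, X, Transfor.ofFunctor (OmegaFunctor.id X)⟩

/-- The domain of degree `n`. -/
def s (n : ℕ) (f : CatCell.{u}) : CatCell.{u} :=
  match n with
  | 0 => ofCat f.dom
  | k + 1 => ⟨f.dom, f.cod, f.arr.s k⟩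

/-- The codomain of degree `n`. -/
def t (n : ℕ) (f : CatCell.{u}) : CatCell.{u} :=
  match n with
  | 0 => ofCat f.cod
  | k + 1 => ⟨f.dom, f.cod, f.arr.t k⟩

theorem dom_eq_cod {f g : CatCell.{u}} (h : s 0 f = t 0 g) : f.dom = g.cod := congrArg dom h

theorem dom_eq {n : ℕ} {f g : CatCell.{u}} (h : s (n + 1) f = t (n + 1) g) : f.dom = g.dom := by
  have : (s (n + 1) f).dom = (t (n + 1) g).dom := by rw [h]
  exact this

theorem cod_eq {n : ℕ} {f g : CatCell.{u}} (h : s (n + 1) f = t (n + 1) g) : f.cod = g.cod := by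
  have : (s (n + 1) f).cod = (t (n + 1) g).cod := by rw [h]
  exact this

theorem arr_eq {n : ℕ} {X Y : OmegaCat.{u}} {α β : Transfor X Y}
    (h : s (n + 1) ⟨X, Y, α⟩ = t (n + 1) ⟨X, Y, β⟩) : α.s n = β.t n := by
  injection h

/-- Composition: horizontal composition for `n = 0`, and composition in the functor category for
positive `n`. -/
def comp (n : ℕ) (f g : CatCell.{u}) (h : s n f = t n g) : CatCell.{u} :=
  match n, f, g, h with
  | 0, ⟨Y, Z, β⟩, ⟨X, Y', α⟩, h =>
    have e : Y' = Y := (dom_eq_cod h).symm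
    ⟨X, Z, β.hcomp (e ▸ α)⟩
  | n + 1, ⟨X, Y, α⟩, ⟨X', Y', β⟩, h =>
    have e₁ : X' = X := (dom_eq h).symm
    have e₂ : Y' = Y := (cod_eq h).symm
    ⟨X, Y, Transfor.comp n α (e₁ ▸ e₂ ▸ β) (by
      subst e₁; subst e₂; exact arr_eq h)⟩

end CatCell

/-- `∞-CAT`, the `∞`-category of `∞`-categories, functors, natural transformations, modifications,
and so on. -/
def infCAT : OmegaCat.{u + 1} where
  Cell := CatCell.{u}
  s := CatCell.s
  t := CatCell.t
  comp := CatCell.comp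
  exists_degree f := by
    obtain ⟨n, hn⟩ := (functorCat f.dom f.cod).exists_degree f.arr
    exact ⟨n + 1, congrArg (CatCell.mk f.dom f.cod) hn⟩
  s_s_of_lt {m n} h x := by
    rcases n with _ | n
    · omega
    · rcases m with _ | m
      · rfl
      · exact congrArg (CatCell.mk x.dom x.cod)
          ((functorCat x.dom x.cod).s_s_of_lt (Nat.lt_of_succ_lt_succ h) x.arr)
  s_t_of_lt {m n} h x := by
    rcases n with _ | n
    · omega
    · rcases m with _ | m
      · rfl
      · exact congrArg (CatCell.mk x.dom x.cod)
          ((functorCat x.dom x.cod).s_t_of_lt (Nat.lt_of_succ_lt_succ h) x.arr)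
  t_s_of_lt {m n} h x := by
    rcases n with _ | n
    · omega
    · rcases m with _ | m
      · rfl
      · exact congrArg (CatCell.mk x.dom x.cod)
          ((functorCat x.dom x.cod).t_s_of_lt (Nat.lt_of_succ_lt_succ h) x.arr)
  t_t_of_lt {m n} h x := by
    rcases n with _ | n
    · omega
    · rcases m with _ | m
      · rfl
      · exact congrArg (CatCell.mk x.dom x.cod)
          ((functorCat x.dom x.cod).t_t_of_lt (Nat.lt_of_succ_lt_succ h) x.arr)
  s_s_of_le {m n} h x := by
    rcases m with _ | m <;> rcases n with _ | n
    · rfl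
    · exact congrArg (CatCell.mk x.dom x.dom)
          ((functorCat x.dom x.dom).s_s_of_le (Nat.zero_le n) (Transfor.ofFunctor _))
    · omega
    · exact congrArg (CatCell.mk x.dom x.cod)
          ((functorCat x.dom x.cod).s_s_of_le (Nat.le_of_succ_le_succ h) x.arr)
  s_t_of_le {m n} h x := by
    rcases m with _ | m <;> rcases n with _ | n
    · rfl
    · exact congrArg (CatCell.mk x.cod x.cod)
          ((functorCat x.cod x.cod).s_s_of_le (Nat.zero_le n) (Transfor.ofFunctor _))
    · omega
    · exact congrArg (CatCell.mk x.dom x.cod)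
          ((functorCat x.dom x.cod).s_t_of_le (Nat.le_of_succ_le_succ h) x.arr)
  t_s_of_le {m n} h x := by
    rcases m with _ | m <;> rcases n with _ | n
    · rfl
    · exact congrArg (CatCell.mk x.dom x.dom)
          ((functorCat x.dom x.dom).t_s_of_le (Nat.zero_le n) (Transfor.ofFunctor _))
    · omega
    · exact congrArg (CatCell.mk x.dom x.cod)
          ((functorCat x.dom x.cod).t_s_of_le (Nat.le_of_succ_le_succ h) x.arr)
  t_t_of_le {m n} h x := by
    rcases m with _ | m <;> rcases n with _ | n
    · rfl
    · exact congrArg (CatCell.mk x.cod x.cod)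
          ((functorCat x.cod x.cod).t_s_of_le (Nat.zero_le n) (Transfor.ofFunctor _))
    · omega
    · exact congrArg (CatCell.mk x.dom x.cod)
          ((functorCat x.dom x.cod).t_t_of_le (Nat.le_of_succ_le_succ h) x.arr)
  s_comp n f g h := by
    obtain ⟨X, Y, α⟩ := f
    obtain ⟨X', Y', β⟩ := g
    rcases n with _ | n
    · obtain rfl : X = Y' := CatCell.dom_eq_cod h
      rfl
    · obtain rfl : X = X' := CatCell.dom_eq h
      obtain rfl : Y = Y' := CatCell.cod_eq h
      exact congrArg (CatCell.mk X Y) ((functorCat X Y).s_comp n α β (CatCell.arr_eq h))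
  t_comp n f g h := by
    obtain ⟨X, Y, α⟩ := f
    obtain ⟨X', Y', β⟩ := g
    rcases n with _ | n
    · obtain rfl : X = Y' := CatCell.dom_eq_cod h
      rfl
    · obtain rfl : X = X' := CatCell.dom_eq h
      obtain rfl : Y = Y' := CatCell.cod_eq h
      exact congrArg (CatCell.mk X Y) ((functorCat X Y).t_comp n α β (CatCell.arr_eq h))
  s_comp_of_lt {n m} hnm f g h := by
    obtain ⟨X, Y, α⟩ := f
    obtain ⟨X', Y', β⟩ := g
    rcases m with _ | m
    · omega
    rcases n with _ | n
    · obtain rfl : X = Y' := CatCell.dom_eq_cod h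
      exact congrArg (CatCell.mk X' Y) (Transfor.s_hcomp m α β)
    · obtain rfl : X = X' := CatCell.dom_eq h
      obtain rfl : Y = Y' := CatCell.cod_eq h
      exact congrArg (CatCell.mk X Y) ((functorCat X Y).s_comp_of_lt
        (Nat.lt_of_succ_lt_succ hnm) α β (CatCell.arr_eq h))
  t_comp_of_lt {n m} hnm f g h := by
    obtain ⟨X, Y, α⟩ := f
    obtain ⟨X', Y', β⟩ := g
    rcases m with _ | m
    · omega
    rcases n with _ | n
    · obtain rfl : X = Y' := CatCell.dom_eq_cod h
      exact congrArg (CatCell.mk X' Y) (Transfor.t_hcomp m α β)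
    · obtain rfl : X = X' := CatCell.dom_eq h
      obtain rfl : Y = Y' := CatCell.cod_eq h
      exact congrArg (CatCell.mk X Y) ((functorCat X Y).t_comp_of_lt
        (Nat.lt_of_succ_lt_succ hnm) α β (CatCell.arr_eq h))
  comp_s n f := by
    obtain ⟨X, Y, α⟩ := f
    rcases n with _ | n
    · exact congrArg (CatCell.mk X Y) (Transfor.hcomp_id α)
    · exact congrArg (CatCell.mk X Y) ((functorCat X Y).comp_s n α)
  t_comp_self n f := by
    obtain ⟨X, Y, α⟩ := f
    rcases n with _ | n
    · exact congrArg (CatCell.mk X Y) (Transfor.id_hcomp α)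
    · exact congrArg (CatCell.mk X Y) ((functorCat X Y).t_comp_self n α)
  assoc n f g k h₁ h₂ := by
    obtain ⟨X, Y, α⟩ := f
    obtain ⟨X', Y', β⟩ := g
    obtain ⟨X'', Y'', γ⟩ := k
    rcases n with _ | n
    · obtain rfl : X = Y' := CatCell.dom_eq_cod h₁
      obtain rfl : X' = Y'' := CatCell.dom_eq_cod h₂
      exact congrArg (CatCell.mk X'' Y) (Transfor.hcomp_assoc α β γ)
    · obtain rfl : X = X' := CatCell.dom_eq h₁
      obtain rfl : Y = Y' := CatCell.cod_eq h₁
      obtain rfl : X = X'' := CatCell.dom_eq h₂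
      obtain rfl : Y = Y'' := CatCell.cod_eq h₂
      exact congrArg (CatCell.mk X Y) ((functorCat X Y).assoc n α β γ
        (CatCell.arr_eq h₁) (CatCell.arr_eq h₂))
  interchange {m n} hmn f g f' g' h h' hf hg := by
    obtain ⟨X, Y, α⟩ := f
    obtain ⟨X', Y', β⟩ := g
    obtain ⟨X₁, Y₁, α'⟩ := f'
    obtain ⟨X₁', Y₁', β'⟩ := g'
    rcases n with _ | n
    · omega
    obtain rfl : X = X' := CatCell.dom_eq h
    obtain rfl : Y = Y' := CatCell.cod_eq h
    obtain rfl : X₁ = X₁' := CatCell.dom_eq h'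
    obtain rfl : Y₁ = Y₁' := CatCell.cod_eq h'
    rcases m with _ | m
    · obtain rfl : X = Y₁ := CatCell.dom_eq_cod hf
      exact congrArg (CatCell.mk X₁ Y) (Transfor.hcomp_comp n α β α' β'
        (CatCell.arr_eq h) (CatCell.arr_eq h') _)
    · obtain rfl : X = X₁ := CatCell.dom_eq hf
      obtain rfl : Y = Y₁ := CatCell.cod_eq hf
      exact congrArg (CatCell.mk X Y) ((functorCat X Y).interchange (Nat.lt_of_succ_lt_succ hmn)
        α β α' β' (CatCell.arr_eq h) (CatCell.arr_eq h') (CatCell.arr_eq hf) (CatCell.arr_eq hg))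

namespace OmegaCat

theorem Obj.s_eq {X : OmegaCat.{u}} (a : X.Obj) (n : ℕ) : X.s n a.1 = a.1 := by
  rw [← a.2, X.s_s_of_le (Nat.zero_le _)]

theorem Obj.t_eq' {X : OmegaCat.{u}} (a : X.Obj) (n : ℕ) : X.t n a.1 = a.1 := by
  rw [← a.2, X.t_s_of_le (Nat.zero_le _)]

theorem Obj.comp_self {X : OmegaCat.{u}} (a : X.Obj) (n : ℕ) :
    X.comp n a.1 a.1 ((a.s_eq n).trans (a.t_eq' n).symm) = a.1 :=
  (X.comp_congr rfl (a.s_eq n).symm _ (X.t_s_of_le le_rfl _).symm).trans (X.comp_s n _)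

theorem s_homComp (L : OmegaCat.{u}) {a b c : L.Obj} (n : ℕ) (g : (L.Hom b c).Cell)
    (f : (L.Hom a b).Cell) :
    (L.Hom a c).s n (L.homComp g f) = L.homComp ((L.Hom b c).s n g) ((L.Hom a b).s n f) :=
  Subtype.ext (L.s_comp_of_lt n.succ_pos _ _ _)

theorem t_homComp (L : OmegaCat.{u}) {a b c : L.Obj} (n : ℕ) (g : (L.Hom b c).Cell)
    (f : (L.Hom a b).Cell) :
    (L.Hom a c).t n (L.homComp g f) = L.homComp ((L.Hom b c).t n g) ((L.Hom a b).t n f) :=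
  Subtype.ext (L.t_comp_of_lt n.succ_pos _ _ _)

theorem homComp_comp (L : OmegaCat.{u}) {a b c : L.Obj} (n : ℕ) (g g' : (L.Hom b c).Cell)
    (f f' : (L.Hom a b).Cell) (hg : (L.Hom b c).s n g = (L.Hom b c).t n g')
    (hf : (L.Hom a b).s n f = (L.Hom a b).t n f')
    (h : (L.Hom a c).s n (L.homComp g f) = (L.Hom a c).t n (L.homComp g' f')) :
    (L.Hom a c).comp n (L.homComp g f) (L.homComp g' f') h =
      L.homComp ((L.Hom b c).comp n g g' hg) ((L.Hom a b).comp n f f' hf) :=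
  Subtype.ext (L.interchange n.succ_pos g.1 g'.1 f.1 f'.1 (congrArg Subtype.val hg)
    (congrArg Subtype.val hf) (g.2.1.trans f.2.2.symm) (g'.2.1.trans f'.2.2.symm)).symm

/-- The functor `L(a, f) : L(a, b) → L(a, c)` for an arrow `f : b → c` of degree `1` in `L`. -/
def postFunctor (L : OmegaCat.{u}) (a : L.Obj) {b c : L.Obj} (f : (L.Hom b c).Obj) :
    OmegaFunctor (L.Hom a b) (L.Hom a c) where
  map g := L.homComp f.1 g
  map_s n g := by rw [s_homComp, f.s_eq]
  map_t n g := by rw [t_homComp, f.t_eq']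
  map_comp n g g' h := by
    rw [homComp_comp L n _ _ _ _ ((f.s_eq n).trans (f.t_eq' n).symm) h, f.comp_self]

/-- The functor `L(f, c) : L(b, c) → L(a, c)` for an arrow `f : a → b` of degree `1` in `L`. -/
def preFunctor (L : OmegaCat.{u}) {a b : L.Obj} (c : L.Obj) (f : (L.Hom a b).Obj) :
    OmegaFunctor (L.Hom b c) (L.Hom a c) where
  map g := L.homComp g f.1
  map_s n g := by rw [s_homComp, f.s_eq]
  map_t n g := by rw [t_homComp, f.t_eq']
  map_comp n g g' h := by
    rw [homComp_comp L n _ _ _ _ h ((f.s_eq n).trans (f.t_eq' n).symm), f.comp_self]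

theorem natural_post (L : OmegaCat.{u}) (a : L.Obj) {b c : L.Obj} (f : (L.Hom b c).Cell) :
    IsNaturalFamily (L.postFunctor a ((L.Hom b c).src f)) (L.postFunctor a ((L.Hom b c).tgt f))
      fun g => L.homComp f g.1 := by
  intro h h₁ h₂
  refine (homComp_comp L 0 f ((L.Hom b c).s 0 f) ((L.Hom a b).t 0 h) h
    ((L.Hom b c).t_s_of_le le_rfl f).symm ((L.Hom a b).s_t_of_le le_rfl h) h₁).trans ?_
  refine Eq.trans ?_ (homComp_comp L 0 ((L.Hom b c).t 0 f) f h ((L.Hom a b).s 0 h)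
    ((L.Hom b c).s_t_of_le le_rfl f) ((L.Hom a b).t_s_of_le le_rfl h).symm h₂).symm
  rw [comp_s, t_comp_self, comp_s, t_comp_self]

theorem natural_pre (L : OmegaCat.{u}) {a b : L.Obj} (c : L.Obj) (f : (L.Hom a b).Cell) :
    IsNaturalFamily (L.preFunctor c ((L.Hom a b).src f)) (L.preFunctor c ((L.Hom a b).tgt f))
      fun g => L.homComp g.1 f := by
  intro h h₁ h₂
  refine (homComp_comp L 0 ((L.Hom b c).t 0 h) h f ((L.Hom a b).s 0 f)
    ((L.Hom b c).s_t_of_le le_rfl h) ((L.Hom a b).t_s_of_le le_rfl f).symm h₁).trans ?_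
  refine Eq.trans ?_ (homComp_comp L 0 h ((L.Hom b c).s 0 h) ((L.Hom a b).t 0 f) f
    ((L.Hom b c).t_s_of_le le_rfl h).symm ((L.Hom a b).s_t_of_le le_rfl f) h₂).symm
  rw [comp_s, t_comp_self, comp_s, t_comp_self]

/-- The covariant hom-functor `L(a, -)` on cells: the cell `L(a, f)` of `∞-CAT` from `L(a, b)` to
`L(a, c)`, with components `g ↦ f * g`, for a cell `f` of any degree from `b` to `c`. -/
def post (L : OmegaCat.{u}) (a : L.Obj) {b c : L.Obj} (f : (L.Hom b c).Cell) :
    Transfor (L.Hom a b) (L.Hom a c) where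
  dom := L.postFunctor a ((L.Hom b c).src f)
  cod := L.postFunctor a ((L.Hom b c).tgt f)
  app g := L.homComp f g.1
  s_app g := by rw [s_homComp, g.s_eq]; rfl
  t_app g := by rw [t_homComp, g.t_eq']; rfl
  exists_degree := by
    obtain ⟨n, hn⟩ := (L.Hom b c).exists_degree f
    exact ⟨n, fun g => by rw [s_homComp, g.s_eq, hn]⟩
  natural_s n := by
    have h := L.natural_post a ((L.Hom b c).s (n + 1) f)
    have e₁ : (L.Hom b c).src ((L.Hom b c).s (n + 1) f) = (L.Hom b c).src f :=
      Subtype.ext ((L.Hom b c).s_s_of_lt n.succ_pos f)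
    have e₂ : (L.Hom b c).tgt ((L.Hom b c).s (n + 1) f) = (L.Hom b c).tgt f :=
      Subtype.ext ((L.Hom b c).t_s_of_lt n.succ_pos f)
    rw [e₁, e₂] at h
    simpa only [s_homComp, Obj.s_eq] using h
  natural_t n := by
    have h := L.natural_post a ((L.Hom b c).t (n + 1) f)
    have e₁ : (L.Hom b c).src ((L.Hom b c).t (n + 1) f) = (L.Hom b c).src f :=
      Subtype.ext ((L.Hom b c).s_t_of_lt n.succ_pos f)
    have e₂ : (L.Hom b c).tgt ((L.Hom b c).t (n + 1) f) = (L.Hom b c).tgt f :=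
      Subtype.ext ((L.Hom b c).t_t_of_lt n.succ_pos f)
    rw [e₁, e₂] at h
    simpa only [t_homComp, Obj.t_eq'] using h

/-- The contravariant hom-functor `L(-, c)` on cells: the cell `L(f, c)` of `∞-CAT` from `L(b, c)`
to `L(a, c)`, with components `g ↦ g * f`, for a cell `f` of any degree from `a` to `b`. -/
def pre (L : OmegaCat.{u}) {a b : L.Obj} (c : L.Obj) (f : (L.Hom a b).Cell) :
    Transfor (L.Hom b c) (L.Hom a c) where
  dom := L.preFunctor c ((L.Hom a b).src f)
  cod := L.preFunctor c ((L.Hom a b).tgt f)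
  app g := L.homComp g.1 f
  s_app g := by rw [s_homComp, g.s_eq]; rfl
  t_app g := by rw [t_homComp, g.t_eq']; rfl
  exists_degree := by
    obtain ⟨n, hn⟩ := (L.Hom a b).exists_degree f
    exact ⟨n, fun g => by rw [s_homComp, g.s_eq, hn]⟩
  natural_s n := by
    have h := L.natural_pre c ((L.Hom a b).s (n + 1) f)
    have e₁ : (L.Hom a b).src ((L.Hom a b).s (n + 1) f) = (L.Hom a b).src f :=
      Subtype.ext ((L.Hom a b).s_s_of_lt n.succ_pos f)
    have e₂ : (L.Hom a b).tgt ((L.Hom a b).s (n + 1) f) = (L.Hom a b).tgt f :=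
      Subtype.ext ((L.Hom a b).t_s_of_lt n.succ_pos f)
    rw [e₁, e₂] at h
    simpa only [s_homComp, Obj.s_eq] using h
  natural_t n := by
    have h := L.natural_pre c ((L.Hom a b).t (n + 1) f)
    have e₁ : (L.Hom a b).src ((L.Hom a b).t (n + 1) f) = (L.Hom a b).src f :=
      Subtype.ext ((L.Hom a b).s_t_of_lt n.succ_pos f)
    have e₂ : (L.Hom a b).tgt ((L.Hom a b).t (n + 1) f) = (L.Hom a b).tgt f :=
      Subtype.ext ((L.Hom a b).t_t_of_lt n.succ_pos f)
    rw [e₁, e₂] at h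
    simpa only [t_homComp, Obj.t_eq'] using h

end OmegaCat

/-- An isomorphism of `∞`-categories. -/
structure OmegaIso (X Y : OmegaCat.{u}) : Type u where
  hom : OmegaFunctor X Y
  inv : OmegaFunctor Y X
  inv_hom : inv.comp hom = OmegaFunctor.id X
  hom_inv : hom.comp inv = OmegaFunctor.id Y

namespace OmegaIso

/-- The inverse isomorphism. -/
def symm {X Y : OmegaCat.{u}} (i : OmegaIso X Y) : OmegaIso Y X := ⟨i.inv, i.hom, i.hom_inv, i.inv_hom⟩

/-- The underlying functor, as a cell of the functor category. -/
def arr {X Y : OmegaCat.{u}} (i : OmegaIso X Y) : Transfor X Y := Transfor.ofFunctor i.hom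

end OmegaIso

/-- A subcategory of an `∞`-category: a set of cells which is closed under domains, codomains and
composites (and then under identities). -/
structure SubOmegaCat (C : OmegaCat.{u}) : Type u where
  carrier : Set C.Cell
  s_mem : ∀ n, ∀ f ∈ carrier, C.s n f ∈ carrier
  t_mem : ∀ n, ∀ f ∈ carrier, C.t n f ∈ carrier
  comp_mem : ∀ n, ∀ f ∈ carrier, ∀ g ∈ carrier, ∀ h : C.s n f = C.t n g, C.comp n f g h ∈ carrier

namespace SubOmegaCat

/-- `f` is a cell of the hom-set `B(X, Y)` of a subcategory `B` of `∞-CAT`. -/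
def HasCell (B : SubOmegaCat infCAT.{u}) {X Y : OmegaCat.{u}} (f : Transfor X Y) : Prop :=
  (⟨X, Y, f⟩ : CatCell.{u}) ∈ B.carrier

/-- `B` contains every functor between two of its objects. -/
def IsFull (B : SubOmegaCat infCAT.{u}) : Prop :=
  ∀ (X Y : OmegaCat.{u}) (F : OmegaFunctor X Y),
    CatCell.ofCat X ∈ B.carrier → CatCell.ofCat Y ∈ B.carrier →
      B.HasCell (Transfor.ofFunctor F)

end SubOmegaCat

open OmegaCat

/-- `L` is concrete over `B` with the forgetful functor `L(A₀, -)`: this functor takes its values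
in `B` and is strictly faithful. -/
def IsConcreteOver (B : SubOmegaCat infCAT.{u}) (L : OmegaCat.{u}) (A₀ : L.Obj) : Prop :=
  (∀ (A A' : L.Obj) (f : (L.Hom A A').Cell), B.HasCell (L.post A₀ f)) ∧
    ∀ A A' : L.Obj, Function.Injective fun f : (L.Hom A A').Cell => L.post A₀ f

/-- The hom-functor `L(-, A₁)` takes its values in `B`. -/
def HomFunctorInto (B : SubOmegaCat infCAT.{u}) (L : OmegaCat.{u}) (A₁ : L.Obj) : Prop :=
  ∀ (A A' : L.Obj) (f : (L.Hom A A').Cell), B.HasCell (L.pre A₁ f)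

/-- A cell `f` of degree `n` from `|Y| = L(A₀, Y)` to `|Y'| = L(A₀, Y')` is an `L`-arrow if it
underlies a cell of degree `n` of `L(Y, Y')`. -/
def IsArrow (L : OmegaCat.{u}) (A₀ : L.Obj) {Y Y' : L.Obj} (n : ℕ)
    (f : Transfor (L.Hom A₀ Y) (L.Hom A₀ Y')) : Prop :=
  ∃ Φ : (L.Hom Y Y').Cell, (L.Hom Y Y').s n Φ = Φ ∧ L.post A₀ Φ = f

section Duality

variable (B : SubOmegaCat infCAT.{u}) {L L' : OmegaCat.{u}} {A₀ A₁ : L.Obj} {B₀ B₁ : L'.Obj}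

/-- Let `φ` identify the underlying objects `L(A₀, A₁)` and `L'(B₀, B₁)`, and let `i A` identify
the underlying object of `G A` with `L(A, A₁)`. The evaluation cones
`{L(x, A₁) : L(A, A₁) → L(A₀, A₁)}`, with `x` of degree `n` in `L(A₀, A)`, are lifted to cones
`{G A → B₁}` in `L'`. -/
def LiftsEvaluationCones (φ : OmegaIso (L.Hom A₀ A₁) (L'.Hom B₀ B₁)) (G : L.Obj → L'.Obj)
    (i : ∀ A, OmegaIso (L'.Hom B₀ (G A)) (L.Hom A A₁)) : Prop :=
  ∀ (A : L.Obj) (n : ℕ) (x : (L.Hom A₀ A).Cell), (L.Hom A₀ A).s n x = x →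
    IsArrow L' B₀ (Y := G A) (Y' := B₁) n (φ.arr.hcomp ((L.pre A₁ x).hcomp (i A).arr))

/-- The lifts `G A` of the `L(A, A₁)` are initial: a cell `f` of degree `n` of `B` from `|Y|` to
`L(A, A₁)` is an `L'`-arrow if and only if its composites with all evaluations at the cells `x` of
degree `n` of `L(A₀, A)` are `L'`-arrows. -/
def IsInitialLift (φ : OmegaIso (L.Hom A₀ A₁) (L'.Hom B₀ B₁)) (G : L.Obj → L'.Obj)
    (i : ∀ A, OmegaIso (L'.Hom B₀ (G A)) (L.Hom A A₁)) : Prop :=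
  ∀ (A : L.Obj) (Y : L'.Obj) (n : ℕ) (f : Transfor (L'.Hom B₀ Y) (L.Hom A A₁)),
    B.HasCell f → f.s n = f →
      (IsArrow L' B₀ (Y := Y) (Y' := G A) n ((i A).symm.arr.hcomp f) ↔
        ∀ x : (L.Hom A₀ A).Cell, (L.Hom A₀ A).s n x = x →
          IsArrow L' B₀ (Y := Y) (Y' := B₁) n (φ.arr.hcomp ((L.pre A₁ x).hcomp f)))

/-- The half of the initial lifting condition for evaluation cones which concerns `L(-, A₁)`: the
`L(A, A₁)` are lifted to objects of `L'`, the evaluation cones are lifted along, and these lifts are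
initial. -/
def InitialLiftingCondition (φ : OmegaIso (L.Hom A₀ A₁) (L'.Hom B₀ B₁)) : Prop :=
  ∃ (G : L.Obj → L'.Obj) (i : ∀ A, OmegaIso (L'.Hom B₀ (G A)) (L.Hom A A₁)),
    LiftsEvaluationCones φ G i ∧ IsInitialLift B φ G i

/-- The action on objects of a contravariant functor. -/
def cobj (G : OmegaFunctor L.op L') (A : L.Obj) : L'.Obj := G.obj (L.opObj A)

/-- The action of a contravariant functor on hom-sets, `L(A, A') → L'(G A', G A)`. -/
def cmap (G : OmegaFunctor L.op L') {A A' : L.Obj} (f : (L.Hom A A').Cell) :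
    (L'.Hom (cobj G A') (cobj G A)).Cell := G.mapHom (L.opHom f)

/-- The functor `G : L^op → L'` is a lifting of `L(-, A₁)` along the forgetful functor of `L'`, by
means of isomorphisms `i A : |G A| ≃ L(A, A₁)` natural in `A`, and this lifting is initial. -/
def IsNaturalLifting (φ : OmegaIso (L.Hom A₀ A₁) (L'.Hom B₀ B₁)) (G : OmegaFunctor L.op L') : Prop :=
  ∃ i : ∀ A, OmegaIso (L'.Hom B₀ (cobj G A)) (L.Hom A A₁),
    (∀ (A A' : L.Obj) (f : (L.Hom A A').Cell),
      (i A).arr.hcomp (L'.post B₀ (cmap G f)) = (L.pre A₁ f).hcomp (i A').arr) ∧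
    IsInitialLift B φ (cobj G) i

/-- `G : L^op → L'` and `F : L'^op → L` form a strict dual adjunction: there are isomorphisms of
`∞`-categories `L(A, F B) ≃ L'(B, G A)` which are natural in `A` and `B`. -/
def IsStrictDualAdjunction (G : OmegaFunctor L.op L') (F : OmegaFunctor L'.op L) : Prop :=
  ∃ θ : ∀ (A : L.Obj) (B : L'.Obj), OmegaIso (L.Hom A (cobj F B)) (L'.Hom B (cobj G A)),
    ∀ (A A' : L.Obj) (B B' : L'.Obj) (x : (L.Hom A' A).Cell) (y : (L'.Hom B' B).Cell),
      (θ A' B').arr.hcomp ((L.pre (cobj F B') x).hcomp (L.post A (cmap F y))) =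
        ((L'.pre (cobj G A') y).hcomp (L'.post B (cmap G x))).hcomp (θ A B).arr

end Duality

/-!
A cell `α` of `[X, Y]` acts on all cells of `X`, horizontal composites act by composition, and `α` is
determined by its action together with those of its domain and codomain functors
(`Transfor.ext_act`). Since `L(A₀, f)` acts as `g ↦ f * g` and `L(f, A₁)` as `g ↦ g * f`, identities
between such cells reduce to identities between composites in `L` and `L'`.

Write `|Y|` for `L'(B₀, Y)` or `L(A₀, Y)`. As the forgetful functors are strictly faithful, a functor
into `[|Y|, |Y'|]` whose values are arrows factors through the hom-set from `Y` to `Y'`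
(`exists_lift_of_isArrow`). All the functors needed arise in this way.

* For a cell `f` from `A` to `A'`, the cell `i_A⁻¹ L(f, A₁) i_{A'}` is an arrow by initiality,
  because `L(x, A₁) L(f, A₁) = L(f * x, A₁)`. Its lifts make the objects `G A` into a functor.
* Initiality, applied to `i_A` itself, shows that the evaluation cones lift. The lifted evaluations
  form a functor `l_A : |A| → L'(G A, B₁)`, and similarly `k_C : |C| → L(F C, A₁)`.
* The transpose of `h` from `A` to `F C` is the lift of `i_A⁻¹ L(h, A₁) k_C`, that is, of
  `y ↦ k_C(y) * h`. Its evaluation at `x` sends `y` to `k_C(y) * (h * x)`, which up to `φ` is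
  `j_C(h * x) * y`. Hence it is the arrow `j_C(h * x)`, and the transpose exists by initiality of
  `G A` (`IsInitialLift.exists_isTranspose`).

A transpose `h'` of `h` satisfies `l_A(x) * h' = j_C(h * x)`, which is symmetric in the two sides
of the duality, so that transposing twice gives `h` back by faithfulness
(`IsTranspose.transpose_transpose`). Naturality of the transposition follows in the same way from
`k_{C'}(z) * F y = k_C(y * z)`.
-/

/-! ### The action of transfors on cells, and whiskering -/

namespace Transfor

variable {X Y Z : OmegaCat.{u}}

/-- The action of a cell of `[X, Y]` on all cells of `X`: its value at `y` is the diagonal of the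
naturality square of `α` at `y`. -/
def act (α : Transfor X Y) (y : X.Cell) : Y.Cell :=
  Y.comp 0 (α.app (X.tgt y)) (α.dom.map y) (by rw [α.s_app, ← α.dom.map_t]; rfl)

theorem act_obj (α : Transfor X Y) (a : X.Obj) : α.act a.1 = α.app a := by
  have e : X.tgt a.1 = a := Subtype.ext a.t_eq
  have e' : α.dom.map a.1 = Y.s 0 (α.app a) := (α.s_app a).symm
  exact (Y.comp_congr (congrArg α.app e) e' _ (Y.t_s_of_le le_rfl _).symm).trans (Y.comp_s 0 _)

@[simp]
theorem act_ofFunctor (F : OmegaFunctor X Y) (y : X.Cell) : (ofFunctor F).act y = F.map y :=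
  (Y.comp_congr (F.map_t 0 y) rfl _ (Y.s_t_of_le le_rfl _)).trans (Y.t_comp_self 0 _)

@[simp]
theorem act_hcomp (β : Transfor Y Z) (α : Transfor X Y) (y : X.Cell) :
    (hcomp β α).act y = β.act (α.act y) := by
  have e : α.cod.obj (X.tgt y) = Y.tgt (α.act y) :=
    Subtype.ext (by
      change _ = Y.t 0 (Y.comp 0 _ _ _)
      rw [Y.t_comp, α.t_app]; rfl)
  refine (Z.assoc 0 _ _ _ _ ?_).trans (Z.comp_congr (congrArg β.app e) ?_ _ _)
  · change _ = Z.t 0 (β.dom.map (α.dom.map y))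
    rw [← β.dom.map_s, ← β.dom.map_t, α.s_app, ← α.dom.map_t]; rfl
  · exact (β.dom.map_comp 0 _ _ _).symm

/-- A cell of `[X, Y]` is determined by its action together with those of its domain functor and
its codomain functor. -/
theorem ext_act {α β : Transfor X Y} (hs : ∀ y, (s 0 α).act y = (s 0 β).act y)
    (ht : ∀ y, (t 0 α).act y = (t 0 β).act y) (h : ∀ y, α.act y = β.act y) : α = β := by
  refine Transfor.ext (OmegaFunctor.ext fun y => ?_) (OmegaFunctor.ext fun y => ?_) fun a => ?_
  · exact (act_ofFunctor _ y).symm.trans ((hs y).trans (act_ofFunctor _ y))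
  · exact (act_ofFunctor _ y).symm.trans ((ht y).trans (act_ofFunctor _ y))
  · rw [← act_obj, h, act_obj]

@[simp]
theorem s_ofFunctor (F : OmegaFunctor X Y) (n : ℕ) : s n (ofFunctor F) = ofFunctor F :=
  (functorCat X Y).s_s_of_le (Nat.zero_le n) (ofFunctor F)

@[simp]
theorem t_ofFunctor (F : OmegaFunctor X Y) (n : ℕ) : t n (ofFunctor F) = ofFunctor F :=
  (functorCat X Y).t_s_of_le (Nat.zero_le n) (ofFunctor F)

theorem hcomp_ofFunctor (G : OmegaFunctor Y Z) (F : OmegaFunctor X Y) :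
    hcomp (ofFunctor G) (ofFunctor F) = ofFunctor (G.comp F) :=
  ext_act (by simp [s_hcomp, OmegaFunctor.comp]) (by simp [t_hcomp, OmegaFunctor.comp])
    (by simp [OmegaFunctor.comp])

theorem comp_ofFunctor_self (F : OmegaFunctor X Y) (n : ℕ)
    (h : s n (ofFunctor F) = t n (ofFunctor F)) :
    comp n (ofFunctor F) (ofFunctor F) h = ofFunctor F :=
  ((functorCat X Y).comp_congr rfl (s_ofFunctor F n).symm h
    ((functorCat X Y).t_s_of_le le_rfl _).symm).trans ((functorCat X Y).comp_s n _)

theorem s_whisker {W : OmegaCat.{u}} (G : OmegaFunctor Y Z) (F : OmegaFunctor W X) (n : ℕ)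
    (α : Transfor X Y) :
    s n (hcomp (ofFunctor G) (hcomp α (ofFunctor F))) =
      hcomp (ofFunctor G) (hcomp (s n α) (ofFunctor F)) := by
  rw [s_hcomp, s_hcomp, s_ofFunctor, s_ofFunctor]

theorem t_whisker {W : OmegaCat.{u}} (G : OmegaFunctor Y Z) (F : OmegaFunctor W X) (n : ℕ)
    (α : Transfor X Y) :
    t n (hcomp (ofFunctor G) (hcomp α (ofFunctor F))) =
      hcomp (ofFunctor G) (hcomp (t n α) (ofFunctor F)) := by
  rw [t_hcomp, t_hcomp, t_ofFunctor, t_ofFunctor]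

theorem whisker_comp {W : OmegaCat.{u}} (G : OmegaFunctor Y Z) (F : OmegaFunctor W X) (n : ℕ)
    (α β : Transfor X Y) (h : s n α = t n β)
    (h' : s n (hcomp (ofFunctor G) (hcomp α (ofFunctor F))) =
      t n (hcomp (ofFunctor G) (hcomp β (ofFunctor F)))) :
    hcomp (ofFunctor G) (hcomp (comp n α β h) (ofFunctor F)) =
      comp n (hcomp (ofFunctor G) (hcomp α (ofFunctor F)))
        (hcomp (ofFunctor G) (hcomp β (ofFunctor F))) h' := by
  have e : s n (hcomp α (ofFunctor F)) = t n (hcomp β (ofFunctor F)) := by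
    rw [s_hcomp, t_hcomp, s_ofFunctor, t_ofFunctor, h]
  have h₁ := hcomp_comp n α β (ofFunctor F) (ofFunctor F) h (by simp) e
  have h₂ := hcomp_comp n (ofFunctor G) (ofFunctor G) (hcomp α (ofFunctor F))
    (hcomp β (ofFunctor F)) (by simp) e h'
  rw [comp_ofFunctor_self] at h₁ h₂
  rw [h₁, h₂]

/-- Whiskering with functors on both sides, `[X, Y] → [W, Z]`. -/
def whisker {W : OmegaCat.{u}} (G : OmegaFunctor Y Z) (F : OmegaFunctor W X) :
    OmegaFunctor (functorCat X Y) (functorCat W Z) where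
  map α := hcomp (ofFunctor G) (hcomp α (ofFunctor F))
  map_s n α := (s_whisker G F n α).symm
  map_t n α := (t_whisker G F n α).symm
  map_comp n α β h := whisker_comp G F n α β h
    ((s_whisker G F n α).trans
      ((congrArg (fun γ => hcomp (ofFunctor G) (hcomp γ (ofFunctor F))) h).trans
        (t_whisker G F n β).symm))

end Transfor

namespace OmegaIso

variable {X Y : OmegaCat.{u}} (i : OmegaIso X Y)

@[simp]
theorem inv_hom_map (x : X.Cell) : i.inv.map (i.hom.map x) = x :=
  congrArg (fun F => F.map x) i.inv_hom

theorem symm_hcomp_hcomp {Z : OmegaCat.{u}} (α : Transfor Z X) :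
    i.symm.arr.hcomp (i.arr.hcomp α) = α := by
  rw [← Transfor.hcomp_assoc, arr, arr, Transfor.hcomp_ofFunctor]
  change Transfor.hcomp (Transfor.ofFunctor (i.inv.comp i.hom)) α = α
  rw [i.inv_hom, Transfor.id_hcomp]

theorem hcomp_symm_hcomp {Z : OmegaCat.{u}} (α : Transfor Z Y) :
    i.arr.hcomp (i.symm.arr.hcomp α) = α :=
  i.symm.symm_hcomp_hcomp α

end OmegaIso

/-! ### Composition along objects and the hom-functors -/

namespace OmegaCat

open Transfor

variable (L : OmegaCat.{u})

@[simp]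
theorem act_post (a : L.Obj) {b c : L.Obj} (f : (L.Hom b c).Cell) (g : (L.Hom a b).Cell) :
    (L.post a f).act g = L.homComp f g := by
  refine (homComp_comp L 0 f ((L.Hom b c).s 0 f) ((L.Hom a b).t 0 g) g
    ((L.Hom b c).t_s_of_le le_rfl f).symm ((L.Hom a b).s_t_of_le le_rfl g) _).trans ?_
  rw [comp_s, t_comp_self]

@[simp]
theorem act_pre {a b : L.Obj} (c : L.Obj) (f : (L.Hom a b).Cell) (g : (L.Hom b c).Cell) :
    (L.pre c f).act g = L.homComp g f := by
  refine (homComp_comp L 0 ((L.Hom b c).t 0 g) g f ((L.Hom a b).s 0 f)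
    ((L.Hom b c).s_t_of_le le_rfl g) ((L.Hom a b).t_s_of_le le_rfl f).symm _).trans ?_
  rw [comp_s, t_comp_self]

theorem homComp_assoc {a b c d : L.Obj} (h : (L.Hom c d).Cell) (g : (L.Hom b c).Cell)
    (f : (L.Hom a b).Cell) : L.homComp (L.homComp h g) f = L.homComp h (L.homComp g f) :=
  Subtype.ext (L.assoc 0 _ _ _ _ _)

/-- The identity of an object `a`, as a cell of `L(a, a)`. -/
def homId (a : L.Obj) : (L.Hom a a).Cell := ⟨a.1, a.2, a.t_eq⟩

theorem s_homId (a : L.Obj) (n : ℕ) : (L.Hom a a).s n (L.homId a) = L.homId a :=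
  Subtype.ext (a.s_eq (n + 1))

theorem t_homId (a : L.Obj) (n : ℕ) : (L.Hom a a).t n (L.homId a) = L.homId a :=
  Subtype.ext (a.t_eq' (n + 1))

@[simp]
theorem homComp_homId {a b : L.Obj} (f : (L.Hom a b).Cell) : L.homComp f (L.homId a) = f :=
  Subtype.ext ((L.comp_congr rfl f.2.1.symm _ (L.t_s_of_le le_rfl _).symm).trans (L.comp_s 0 _))

@[simp]
theorem homId_homComp {a b : L.Obj} (f : (L.Hom a b).Cell) : L.homComp (L.homId b) f = f :=
  Subtype.ext ((L.comp_congr f.2.2.symm rfl _ (L.s_t_of_le le_rfl _)).trans (L.t_comp_self 0 _))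

theorem s_post (a : L.Obj) {b c : L.Obj} (f : (L.Hom b c).Cell) (n : ℕ) :
    (L.post a f).s n = L.post a ((L.Hom b c).s n f) := by
  have e₁ : (L.Hom b c).src ((L.Hom b c).s n f) = (L.Hom b c).src f := Subtype.ext (by
    rcases n with _ | n
    · exact (L.Hom b c).s_s_of_le le_rfl f
    · exact (L.Hom b c).s_s_of_lt n.succ_pos f)
  rcases n with _ | n
  · refine Transfor.ext (congrArg (L.postFunctor a) e₁.symm) (congrArg (L.postFunctor a) ?_)
      fun g => rfl
    exact Subtype.ext ((L.Hom b c).t_s_of_le le_rfl f).symm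
  · refine Transfor.ext (congrArg (L.postFunctor a) e₁.symm) (congrArg (L.postFunctor a) ?_)
      fun g => ?_
    · exact Subtype.ext ((L.Hom b c).t_s_of_lt n.succ_pos f).symm
    · refine (s_homComp L (n + 1) f g.1).trans ?_
      rw [g.s_eq]; rfl

theorem t_post (a : L.Obj) {b c : L.Obj} (f : (L.Hom b c).Cell) (n : ℕ) :
    (L.post a f).t n = L.post a ((L.Hom b c).t n f) := by
  rcases n with _ | n
  · refine Transfor.ext (congrArg (L.postFunctor a) ?_) (congrArg (L.postFunctor a) ?_)
      fun g => rfl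
    · exact Subtype.ext ((L.Hom b c).s_t_of_le le_rfl f).symm
    · exact Subtype.ext ((L.Hom b c).t_t_of_le le_rfl f).symm
  · refine Transfor.ext (congrArg (L.postFunctor a) ?_) (congrArg (L.postFunctor a) ?_)
      fun g => ?_
    · exact Subtype.ext ((L.Hom b c).s_t_of_lt n.succ_pos f).symm
    · exact Subtype.ext ((L.Hom b c).t_t_of_lt n.succ_pos f).symm
    · refine (t_homComp L (n + 1) f g.1).trans ?_
      rw [g.t_eq']; rfl

theorem s_pre {a b : L.Obj} (c : L.Obj) (f : (L.Hom a b).Cell) (n : ℕ) :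
    (L.pre c f).s n = L.pre c ((L.Hom a b).s n f) := by
  rcases n with _ | n
  · refine Transfor.ext (congrArg (L.preFunctor c) ?_) (congrArg (L.preFunctor c) ?_)
      fun g => rfl
    · exact Subtype.ext ((L.Hom a b).s_s_of_le le_rfl f).symm
    · exact Subtype.ext ((L.Hom a b).t_s_of_le le_rfl f).symm
  · refine Transfor.ext (congrArg (L.preFunctor c) ?_) (congrArg (L.preFunctor c) ?_)
      fun g => ?_
    · exact Subtype.ext ((L.Hom a b).s_s_of_lt n.succ_pos f).symm
    · exact Subtype.ext ((L.Hom a b).t_s_of_lt n.succ_pos f).symm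
    · refine (s_homComp L (n + 1) g.1 f).trans ?_
      rw [g.s_eq]; rfl

theorem t_pre {a b : L.Obj} (c : L.Obj) (f : (L.Hom a b).Cell) (n : ℕ) :
    (L.pre c f).t n = L.pre c ((L.Hom a b).t n f) := by
  rcases n with _ | n
  · refine Transfor.ext (congrArg (L.preFunctor c) ?_) (congrArg (L.preFunctor c) ?_)
      fun g => rfl
    · exact Subtype.ext ((L.Hom a b).s_t_of_le le_rfl f).symm
    · exact Subtype.ext ((L.Hom a b).t_t_of_le le_rfl f).symm
  · refine Transfor.ext (congrArg (L.preFunctor c) ?_) (congrArg (L.preFunctor c) ?_)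
      fun g => ?_
    · exact Subtype.ext ((L.Hom a b).s_t_of_lt n.succ_pos f).symm
    · exact Subtype.ext ((L.Hom a b).t_t_of_lt n.succ_pos f).symm
    · refine (t_homComp L (n + 1) g.1 f).trans ?_
      rw [g.t_eq']; rfl

theorem post_comp (a : L.Obj) {b c : L.Obj} (n : ℕ) (f g : (L.Hom b c).Cell)
    (h : (L.Hom b c).s n f = (L.Hom b c).t n g) (h' : (L.post a f).s n = (L.post a g).t n) :
    L.post a ((L.Hom b c).comp n f g h) = Transfor.comp n (L.post a f) (L.post a g) h' := by
  have e : ∀ x : (L.Hom a b).Obj, (L.Hom a c).s n (L.homComp f x.1) =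
      (L.Hom a c).t n (L.homComp g x.1) := fun x => by
    rw [s_homComp, t_homComp, h, x.s_eq, x.t_eq']
  have key : ∀ x : (L.Hom a b).Obj, L.homComp ((L.Hom b c).comp n f g h) x.1 =
      (L.Hom a c).comp n (L.homComp f x.1) (L.homComp g x.1) (e x) := fun x => by
    rw [homComp_comp L n f g x.1 x.1 h ((x.s_eq n).trans (x.t_eq' n).symm) (e x), x.comp_self]
  rcases n with _ | n
  · refine Transfor.ext (congrArg (L.postFunctor a) ?_) (congrArg (L.postFunctor a) ?_)
      key
    · exact Subtype.ext ((L.Hom b c).s_comp 0 f g h)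
    · exact Subtype.ext ((L.Hom b c).t_comp 0 f g h)
  · refine Transfor.ext (congrArg (L.postFunctor a) ?_) (congrArg (L.postFunctor a) ?_)
      key
    · exact Subtype.ext ((L.Hom b c).s_comp_lt n.succ_pos f g h)
    · exact Subtype.ext ((L.Hom b c).t_comp_lt n.succ_pos f g h)

theorem pre_comp {a b : L.Obj} (c : L.Obj) (n : ℕ) (f g : (L.Hom a b).Cell)
    (h : (L.Hom a b).s n f = (L.Hom a b).t n g) (h' : (L.pre c f).s n = (L.pre c g).t n) :
    L.pre c ((L.Hom a b).comp n f g h) = Transfor.comp n (L.pre c f) (L.pre c g) h' := by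
  have e : ∀ x : (L.Hom b c).Obj, (L.Hom a c).s n (L.homComp x.1 f) =
      (L.Hom a c).t n (L.homComp x.1 g) := fun x => by
    rw [s_homComp, t_homComp, h, x.s_eq, x.t_eq']
  have key : ∀ x : (L.Hom b c).Obj, L.homComp x.1 ((L.Hom a b).comp n f g h) =
      (L.Hom a c).comp n (L.homComp x.1 f) (L.homComp x.1 g) (e x) := fun x => by
    rw [homComp_comp L n x.1 x.1 f g ((x.s_eq n).trans (x.t_eq' n).symm) h (e x), x.comp_self]
  rcases n with _ | n
  · refine Transfor.ext (congrArg (L.preFunctor c) ?_) (congrArg (L.preFunctor c) ?_)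
      key
    · exact Subtype.ext ((L.Hom a b).s_comp 0 f g h)
    · exact Subtype.ext ((L.Hom a b).t_comp 0 f g h)
  · refine Transfor.ext (congrArg (L.preFunctor c) ?_) (congrArg (L.preFunctor c) ?_)
      key
    · exact Subtype.ext ((L.Hom a b).s_comp_lt n.succ_pos f g h)
    · exact Subtype.ext ((L.Hom a b).t_comp_lt n.succ_pos f g h)

/-- The covariant hom-functor `L(a, -)` on a hom-set, `L(b, c) → [L(a, b), L(a, c)]`. -/
def postHom (a b c : L.Obj) :
    OmegaFunctor (L.Hom b c) (functorCat (L.Hom a b) (L.Hom a c)) where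
  map f := L.post a f
  map_s n f := (L.s_post a f n).symm
  map_t n f := (L.t_post a f n).symm
  map_comp n f g h := L.post_comp a n f g h _

/-- The contravariant hom-functor `L(-, c)` on a hom-set, `L(a, b) → [L(b, c), L(a, c)]`. -/
def preHom (a b c : L.Obj) :
    OmegaFunctor (L.Hom a b) (functorCat (L.Hom b c) (L.Hom a c)) where
  map f := L.pre c f
  map_s n f := (L.s_pre c f n).symm
  map_t n f := (L.t_pre c f n).symm
  map_comp n f g h := L.pre_comp c n f g h _

theorem post_homComp (a : L.Obj) {b c d : L.Obj} (g : (L.Hom c d).Cell) (f : (L.Hom b c).Cell) :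
    L.post a (L.homComp g f) = (L.post a g).hcomp (L.post a f) := by
  refine ext_act ?_ ?_ ?_ <;>
    simp [s_hcomp, t_hcomp, s_post, t_post, s_homComp, t_homComp, homComp_assoc]

theorem pre_homComp {a b c : L.Obj} (d : L.Obj) (g : (L.Hom b c).Cell) (f : (L.Hom a b).Cell) :
    L.pre d (L.homComp g f) = (L.pre d f).hcomp (L.pre d g) := by
  refine ext_act ?_ ?_ ?_ <;>
    simp [s_hcomp, t_hcomp, s_pre, t_pre, s_homComp, t_homComp, homComp_assoc]

theorem post_homId (a b : L.Obj) : L.post a (L.homId b) = ofFunctor (OmegaFunctor.id _) := by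
  refine ext_act ?_ ?_ ?_ <;> simp [s_post, t_post, s_homId, t_homId, OmegaFunctor.id]

theorem pre_homId (a b : L.Obj) : L.pre b (L.homId a) = ofFunctor (OmegaFunctor.id _) := by
  refine ext_act ?_ ?_ ?_ <;> simp [s_pre, t_pre, s_homId, t_homId, OmegaFunctor.id]

end OmegaCat

open Transfor

/-! ### Lifting families of arrows -/

namespace SubOmegaCat

variable {B : SubOmegaCat infCAT.{u}} {X Y Z : OmegaCat.{u}}

theorem HasCell.hcomp {β : Transfor Y Z} {α : Transfor X Y} (hβ : B.HasCell β)
    (hα : B.HasCell α) : B.HasCell (β.hcomp α) :=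
  B.comp_mem 0 _ hβ _ hα rfl

theorem HasCell.dom_mem {α : Transfor X Y} (hα : B.HasCell α) : CatCell.ofCat X ∈ B.carrier :=
  B.s_mem 0 _ hα

end SubOmegaCat

section Lifting

variable {L : OmegaCat.{u}} {A₀ : L.Obj}

/-- A functor into `[|Y|, |Y'|]` all of whose values are `L`-arrows factors through `L(Y, Y')`: by
strict faithfulness the lifts of the single cells are unique, and so are compatible with domains,
codomains and composites. -/
theorem exists_lift_of_isArrow
    (hL : ∀ A A' : L.Obj, Function.Injective fun f : (L.Hom A A').Cell => L.post A₀ f)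
    {Y Y' : L.Obj} {K : OmegaCat.{u}}
    (T : OmegaFunctor K (functorCat (L.Hom A₀ Y) (L.Hom A₀ Y')))
    (hT : ∀ n k, K.s n k = k → IsArrow L A₀ n (T.map k)) :
    ∃ S : OmegaFunctor K (L.Hom Y Y'), ∀ k, L.post A₀ (S.map k) = T.map k := by
  have hex : ∀ k, ∃ Φ : (L.Hom Y Y').Cell, L.post A₀ Φ = T.map k := fun k => by
    obtain ⟨n, hn⟩ := K.exists_degree k
    obtain ⟨Φ, -, hΦ⟩ := hT n k hn
    exact ⟨Φ, hΦ⟩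
  choose S hS using hex
  have hs : ∀ n k, S (K.s n k) = (L.Hom Y Y').s n (S k) := fun n k => hL _ _ <| by
    change L.post A₀ _ = L.post A₀ _
    rw [hS, T.map_s, ← hS]
    exact L.s_post A₀ (S k) n
  have ht : ∀ n k, S (K.t n k) = (L.Hom Y Y').t n (S k) := fun n k => hL _ _ <| by
    change L.post A₀ _ = L.post A₀ _
    rw [hS, T.map_t, ← hS]
    exact L.t_post A₀ (S k) n
  refine ⟨⟨S, hs, ht, fun n f g h => hL _ _ ?_⟩, hS⟩
  have e : (L.Hom Y Y').s n (S f) = (L.Hom Y Y').t n (S g) := by rw [← hs, ← ht, h]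
  change L.post A₀ _ = L.post A₀ _
  refine (hS _).trans ((T.map_comp n f g h).trans ?_)
  refine Eq.trans ?_ ((L.postHom A₀ Y Y').map_comp n (S f) (S g) e).symm
  exact (functorCat _ _).comp_congr (hS f).symm (hS g).symm _ _

end Lifting

/-! ### Evaluation lifts and transposes -/

section Duality

variable {B : SubOmegaCat infCAT.{u}} {L L' : OmegaCat.{u}} {A₀ A₁ : L.Obj} {B₀ B₁ : L'.Obj}
  {φ : OmegaIso (L.Hom A₀ A₁) (L'.Hom B₀ B₁)}

theorem IsConcreteOver.obj_mem (hL : IsConcreteOver B L A₀) (A : L.Obj) :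
    CatCell.ofCat (L.Hom A₀ A) ∈ B.carrier :=
  (hL.1 A A (L.homId A)).dom_mem

theorem HomFunctorInto.obj_mem (hL : HomFunctorInto B L A₁) (A : L.Obj) :
    CatCell.ofCat (L.Hom A A₁) ∈ B.carrier :=
  (hL A A (L.homId A)).dom_mem

/-- Initiality alone lifts the evaluation cones: apply it to the isomorphism `i A` itself, whose
composite with `(i A)⁻¹` is the identity. -/
theorem IsInitialLift.liftsEvaluationCones (hB : B.IsFull) (hL' : IsConcreteOver B L' B₀)
    (hA₁ : HomFunctorInto B L A₁) {G : L.Obj → L'.Obj}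
    {i : ∀ A, OmegaIso (L'.Hom B₀ (G A)) (L.Hom A A₁)} (hi : IsInitialLift B φ G i) :
    LiftsEvaluationCones φ G i := by
  intro A n x hx
  refine (hi A (G A) n (i A).arr (hB _ _ _ (hL'.obj_mem _) (hA₁.obj_mem _))
    (s_ofFunctor _ n)).1 ⟨L'.homId (G A), L'.s_homId _ n, ?_⟩ x hx
  rw [post_homId, ← Transfor.hcomp_id (i A).arr, OmegaIso.symm_hcomp_hcomp]

/-- `k A : L(A₀, A) → L'(G A, B₁)` sends a cell `x` to the lift of the evaluation at `x`. -/
def IsEvaluationLift (φ : OmegaIso (L.Hom A₀ A₁) (L'.Hom B₀ B₁)) {G : L.Obj → L'.Obj}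
    (i : ∀ A, OmegaIso (L'.Hom B₀ (G A)) (L.Hom A A₁))
    (k : ∀ A, OmegaFunctor (L.Hom A₀ A) (L'.Hom (G A) B₁)) : Prop :=
  ∀ A x, L'.post B₀ ((k A).map x) = φ.arr.hcomp ((L.pre A₁ x).hcomp (i A).arr)

theorem LiftsEvaluationCones.exists_isEvaluationLift (hL' : IsConcreteOver B L' B₀)
    {G : L.Obj → L'.Obj} {i : ∀ A, OmegaIso (L'.Hom B₀ (G A)) (L.Hom A A₁)}
    (h : LiftsEvaluationCones φ G i) : ∃ k, IsEvaluationLift φ i k := by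
  have := fun A => exists_lift_of_isArrow hL'.2
    ((Transfor.whisker φ.hom (i A).hom).comp (L.preHom A₀ A A₁)) (fun n x hx => h A n x hx)
  choose k hk using this
  exact ⟨k, hk⟩

namespace IsEvaluationLift

variable {G : L.Obj → L'.Obj} {i : ∀ A, OmegaIso (L'.Hom B₀ (G A)) (L.Hom A A₁)}
  {k : ∀ A, OmegaFunctor (L.Hom A₀ A) (L'.Hom (G A) B₁)}

theorem homComp_map (hk : IsEvaluationLift φ i k) {A : L.Obj} (x : (L.Hom A₀ A).Cell)
    (z : (L'.Hom B₀ (G A)).Cell) :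
    L'.homComp ((k A).map x) z = φ.hom.map (L.homComp ((i A).hom.map z) x) := by
  have := congrArg (fun α => α.act z) (hk A x)
  simpa [OmegaIso.arr] using this

/-- The evaluation at `z` of the functor `k A` is, up to `φ`, the `L`-arrow of the cell of `L(A, A₁)`
which corresponds to `z`: both send `x` to the value at `z` of the evaluation at `x`. -/
theorem hcomp_pre (hk : IsEvaluationLift φ i k) {A : L.Obj} (z : (L'.Hom B₀ (G A)).Cell) :
    φ.symm.arr.hcomp ((L'.pre B₁ z).hcomp (ofFunctor (k A))) = L.post A₀ ((i A).hom.map z) := by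
  refine ext_act ?_ ?_ ?_ <;>
    simp [OmegaIso.arr, OmegaIso.symm, s_hcomp, t_hcomp, s_pre, t_pre, s_post, t_post,
      hk.homComp_map, ← OmegaFunctor.map_s, ← OmegaFunctor.map_t]

end IsEvaluationLift

/-- `θ A C` sends a cell `h` from `A` to `F C` to its transpose from `C` to `G A`, the lift of the
cell `y ↦ k(y) * h` from `L'(B₀, C)` to `L(A, A₁)`. -/
def IsTranspose {G : L.Obj → L'.Obj} {F : L'.Obj → L.Obj}
    (i : ∀ A, OmegaIso (L'.Hom B₀ (G A)) (L.Hom A A₁))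
    (k : ∀ C, OmegaFunctor (L'.Hom B₀ C) (L.Hom (F C) A₁))
    (θ : ∀ A C, OmegaFunctor (L.Hom A (F C)) (L'.Hom C (G A))) : Prop :=
  ∀ A C h, L'.post B₀ ((θ A C).map h) =
    (i A).symm.arr.hcomp ((L.pre A₁ h).hcomp (ofFunctor (k C)))

variable {G : L.Obj → L'.Obj} {i : ∀ A, OmegaIso (L'.Hom B₀ (G A)) (L.Hom A A₁)}
  {F : L'.Obj → L.Obj} {j : ∀ C, OmegaIso (L.Hom A₀ (F C)) (L'.Hom C B₁)}
  {k : ∀ C, OmegaFunctor (L'.Hom B₀ C) (L.Hom (F C) A₁)}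
  {l : ∀ A, OmegaFunctor (L.Hom A₀ A) (L'.Hom (G A) B₁)}

/-- Transposes exist by initiality of `G A`: the evaluation at `x` of `y ↦ k(y) * h` is the
`L'`-arrow which corresponds to the element `h * x` of `F C`. -/
theorem IsInitialLift.exists_isTranspose (hB : B.IsFull) (hL' : IsConcreteOver B L' B₀)
    (hA₁ : HomFunctorInto B L A₁) (hi : IsInitialLift B φ G i)
    (hk : IsEvaluationLift φ.symm j k) : ∃ θ, IsTranspose i k θ := by
  have := fun A C => exists_lift_of_isArrow hL'.2
    ((Transfor.whisker (i A).inv (k C)).comp (L.preHom A (F C) A₁)) (fun n h hh => by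
      refine (hi A C n ((L.pre A₁ h).hcomp (ofFunctor (k C)))
        ((hA₁ _ _ h).hcomp (hB _ _ _ (hL'.obj_mem _) (hA₁.obj_mem _))) ?_).2 fun x hx => ?_
      · rw [s_hcomp, s_pre, hh, s_ofFunctor]
      · refine ⟨(j C).hom.map (L.homComp h x), ?_, ?_⟩
        · rw [← OmegaFunctor.map_s, s_homComp, hh, hx]
        · rw [← Transfor.hcomp_assoc (L.pre A₁ x), ← pre_homComp]
          exact (hk.hcomp_pre (L.homComp h x)).symm)
  choose θ hθ using this
  exact ⟨θ, hθ⟩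

/-- Transposing twice is the identity: both composites are determined by the evaluations
`h * x` of `h`, by faithfulness of the two forgetful functors. -/
theorem IsTranspose.transpose_transpose (hL : IsConcreteOver B L A₀)
    (hL' : IsConcreteOver B L' B₀) (hl : IsEvaluationLift φ i l) (hk : IsEvaluationLift φ.symm j k)
    {θ : ∀ A C, OmegaFunctor (L.Hom A (F C)) (L'.Hom C (G A))}
    {θ' : ∀ C A, OmegaFunctor (L'.Hom C (G A)) (L.Hom A (F C))}
    (hθ : IsTranspose i k θ) (hθ' : IsTranspose j l θ') {A : L.Obj} {C : L'.Obj}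
    (h : (L.Hom A (F C)).Cell) : (θ' C A).map ((θ A C).map h) = h := by
  have key : ∀ (h : (L.Hom A (F C)).Cell) (x : (L.Hom A₀ A).Cell),
      L'.homComp ((l A).map x) ((θ A C).map h) = (j C).hom.map (L.homComp h x) := fun h x => by
    refine hL'.2 _ _ ?_
    change L'.post B₀ _ = L'.post B₀ _
    rw [post_homComp, hl, hθ, Transfor.hcomp_assoc, Transfor.hcomp_assoc,
      OmegaIso.hcomp_symm_hcomp, ← Transfor.hcomp_assoc (L.pre A₁ x), ← pre_homComp]
    exact hk.hcomp_pre _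
  have key' : (L'.pre B₁ ((θ A C).map h)).hcomp (ofFunctor (l A)) =
      (j C).arr.hcomp (L.post A₀ h) := by
    refine ext_act ?_ ?_ ?_ <;>
      simp [OmegaIso.arr, s_hcomp, t_hcomp, s_pre, t_pre, s_post, t_post,
        ← OmegaFunctor.map_s, ← OmegaFunctor.map_t, key]
  refine hL.2 _ _ ?_
  change L.post A₀ _ = L.post A₀ _
  rw [hθ', key', OmegaIso.symm_hcomp_hcomp]

end Duality

/-! ### Contravariant functors given on hom-sets -/

section Contravariant

variable {L L' : OmegaCat.{u}}

theorem cmap_s (G : OmegaFunctor L.op L') {A A' : L.Obj} (n : ℕ) (f : (L.Hom A A').Cell) :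
    cmap G ((L.Hom A A').s n f) = (L'.Hom _ _).s n (cmap G f) :=
  Subtype.ext (G.map_s (n + 1) f.1)

theorem cmap_t (G : OmegaFunctor L.op L') {A A' : L.Obj} (n : ℕ) (f : (L.Hom A A').Cell) :
    cmap G ((L.Hom A A').t n f) = (L'.Hom _ _).t n (cmap G f) :=
  Subtype.ext (G.map_t (n + 1) f.1)

/-- A contravariant functor is given by its values on objects and by functors between hom-sets
which are compatible with identities and with composition along objects. -/
theorem exists_contravariant {G₀ : L.Obj → L'.Obj}
    (g : ∀ A A', OmegaFunctor (L.Hom A A') (L'.Hom (G₀ A') (G₀ A)))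
    (g_id : ∀ A, (g A A).map (L.homId A) = L'.homId (G₀ A))
    (g_comp : ∀ A A' A'' (f' : (L.Hom A' A'').Cell) (f : (L.Hom A A').Cell),
      (g A A'').map (L.homComp f' f) = L'.homComp ((g A A').map f) ((g A' A'').map f')) :
    ∃ G : OmegaFunctor L.op L', cobj G = G₀ ∧
      ∀ A A' (f : (L.Hom A A').Cell), G.map f.1 = ((g A A').map f).1 := by
  let m : L.Cell → L'.Cell := fun x => ((g (L.src x) (L.tgt x)).map ⟨x, rfl, rfl⟩).1
  have hm : ∀ A A' (f : (L.Hom A A').Cell), m f.1 = ((g A A').map f).1 := by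
    rintro A A' ⟨x, hx, hx'⟩
    obtain rfl : L.src x = A := Subtype.ext hx
    obtain rfl : L.tgt x = A' := Subtype.ext hx'
    rfl
  have hobj : ∀ A : L.Obj, m A.1 = (G₀ A).1 := fun A =>
    (hm A A (L.homId A)).trans (congrArg Subtype.val (g_id A))
  refine ⟨⟨m, fun n x => ?_, fun n x => ?_, fun n f f' h => ?_⟩, ?_, hm⟩
  · rcases n with _ | n
    · exact (hobj (L.tgt x)).trans ((g (L.src x) (L.tgt x)).map ⟨x, rfl, rfl⟩).2.1.symm
    · exact (hm (L.src x) (L.tgt x) ((L.Hom _ _).s n ⟨x, rfl, rfl⟩)).trans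
        (congrArg Subtype.val ((g (L.src x) (L.tgt x)).map_s n ⟨x, rfl, rfl⟩))
  · rcases n with _ | n
    · exact (hobj (L.src x)).trans ((g (L.src x) (L.tgt x)).map ⟨x, rfl, rfl⟩).2.2.symm
    · exact (hm (L.src x) (L.tgt x) ((L.Hom _ _).t n ⟨x, rfl, rfl⟩)).trans
        (congrArg Subtype.val ((g (L.src x) (L.tgt x)).map_t n ⟨x, rfl, rfl⟩))
  · rcases n with _ | n
    · have e : L.t 0 f = L.s 0 f' := h
      let a : (L.Hom (L.src f) (L.tgt f)).Cell := ⟨f, rfl, rfl⟩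
      let b : (L.Hom (L.tgt f) (L.tgt f')).Cell := ⟨f', e.symm, rfl⟩
      refine (hm _ _ (L.homComp b a)).trans ((congrArg Subtype.val (g_comp _ _ _ b a)).trans ?_)
      exact L'.comp_congr (hm _ _ a).symm (hm _ _ b).symm _ _
    · have e : L.s (n + 1) f = L.t (n + 1) f' := h
      have es : L.s 0 f' = L.s 0 f :=
        (L.s_t_of_lt n.succ_pos f').symm.trans
          ((congrArg (L.s 0) e.symm).trans (L.s_s_of_lt n.succ_pos f))
      have et : L.t 0 f' = L.t 0 f :=
        (L.t_t_of_lt n.succ_pos f').symm.trans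
          ((congrArg (L.t 0) e.symm).trans (L.t_s_of_lt n.succ_pos f))
      let a : (L.Hom (L.src f) (L.tgt f)).Cell := ⟨f, rfl, rfl⟩
      let b : (L.Hom (L.src f) (L.tgt f)).Cell := ⟨f', es, et⟩
      have eab : (L.Hom (L.src f) (L.tgt f)).s n a = (L.Hom (L.src f) (L.tgt f)).t n b :=
        Subtype.ext e
      refine (hm _ _ ((L.Hom _ _).comp n a b eab)).trans
        ((congrArg Subtype.val ((g _ _).map_comp n a b eab)).trans ?_)
      exact L'.comp_congr (hm _ _ a).symm (hm _ _ b).symm _ _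
  · exact funext fun A => Subtype.ext (hobj A)

end Contravariant

/-! ### Natural liftings and the dual adjunction -/

section Duality

variable {B : SubOmegaCat infCAT.{u}} {L L' : OmegaCat.{u}} {A₀ A₁ : L.Obj} {B₀ B₁ : L'.Obj}
  {φ : OmegaIso (L.Hom A₀ A₁) (L'.Hom B₀ B₁)}

/-- Under the initial lifting condition `L(-, A₁)` has a natural initial lifting: for a cell `f` from
`A` to `A'` the cell `L(f, A₁)` lifts to a cell from `G A'` to `G A`, because its evaluation at `x`
is the evaluation of `L(A', A₁)` at `f * x`. -/
theorem InitialLiftingCondition.exists_isNaturalLifting (hB : B.IsFull)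
    (hL' : IsConcreteOver B L' B₀) (hA₁ : HomFunctorInto B L A₁)
    (h : InitialLiftingCondition B φ) : ∃ G : OmegaFunctor L.op L', IsNaturalLifting B φ G := by
  obtain ⟨G₀, i, hev, hi⟩ := h
  have := fun A A' => exists_lift_of_isArrow hL'.2
    ((Transfor.whisker (i A).inv (i A').hom).comp (L.preHom A A' A₁)) (fun n f hf => by
      refine (hi A (G₀ A') n ((L.pre A₁ f).hcomp (i A').arr)
        ((hA₁ _ _ f).hcomp (hB _ _ _ (hL'.obj_mem _) (hA₁.obj_mem _))) ?_).2 fun x hx => ?_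
      · rw [s_hcomp, s_pre, hf, OmegaIso.arr, s_ofFunctor]
      · rw [← Transfor.hcomp_assoc (L.pre A₁ x), ← pre_homComp]
        exact hev A' n _ (by rw [s_homComp, hf, hx]))
  choose g hg using this
  replace hg : ∀ A A' f, L'.post B₀ ((g A A').map f) =
    (i A).symm.arr.hcomp ((L.pre A₁ f).hcomp (i A').arr) := hg
  obtain ⟨G, hG₀, hG⟩ := exists_contravariant g
    (fun A => hL'.2 _ _ (by
      change L'.post B₀ _ = L'.post B₀ _
      rw [hg, pre_homId, post_homId, Transfor.id_hcomp, ← Transfor.hcomp_id (i A).arr,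
        OmegaIso.symm_hcomp_hcomp]))
    (fun A A' A'' f' f => hL'.2 _ _ (by
      change L'.post B₀ _ = L'.post B₀ _
      rw [post_homComp, hg, hg, hg, pre_homComp]
      simp only [Transfor.hcomp_assoc, OmegaIso.hcomp_symm_hcomp]))
  subst hG₀
  refine ⟨G, i, fun A A' f => ?_, hi⟩
  have e : cmap G f = (g A A').map f := Subtype.ext (hG A A' f)
  rw [e, hg, OmegaIso.hcomp_symm_hcomp]

/-- Evaluation lifts are natural in `A` when the objects `G A` are the values of a functor `G` and
the isomorphisms `i A` are natural. -/
theorem IsEvaluationLift.hcomp_ofFunctor (hL' : IsConcreteOver B L' B₀) {G : OmegaFunctor L.op L'}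
    {i : ∀ A, OmegaIso (L'.Hom B₀ (cobj G A)) (L.Hom A A₁)}
    (hi : ∀ (A A' : L.Obj) (f : (L.Hom A A').Cell),
      (i A).arr.hcomp (L'.post B₀ (cmap G f)) = (L.pre A₁ f).hcomp (i A').arr)
    {l : ∀ A, OmegaFunctor (L.Hom A₀ A) (L'.Hom (cobj G A) B₁)} (hl : IsEvaluationLift φ i l)
    {A A' : L.Obj} (f : (L.Hom A A').Cell) :
    (L'.pre B₁ (cmap G f)).hcomp (ofFunctor (l A)) =
      (ofFunctor (l A')).hcomp (L.post A₀ f) := by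
  have key : ∀ (f : (L.Hom A A').Cell) (x : (L.Hom A₀ A).Cell),
      L'.homComp ((l A).map x) (cmap G f) = (l A').map (L.homComp f x) := fun f x => by
    refine hL'.2 _ _ ?_
    change L'.post B₀ _ = L'.post B₀ _
    rw [post_homComp, hl, hl, pre_homComp]
    simp only [Transfor.hcomp_assoc, hi]
  refine ext_act ?_ ?_ ?_ <;>
    simp [s_hcomp, t_hcomp, s_pre, t_pre, s_post, t_post, ← cmap_s, ← cmap_t, key]

/-- The transposes attached to two natural initial liftings form a dual adjunction: they are inverse to
each other, and naturality is inherited from that of `i` and of the evaluation lifts. -/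
theorem isStrictDualAdjunction_of_isNaturalLifting (hB : B.IsFull)
    (hL : IsConcreteOver B L A₀) (hL' : IsConcreteOver B L' B₀)
    (hA₁ : HomFunctorInto B L A₁) (hB₁ : HomFunctorInto B L' B₁)
    {G : OmegaFunctor L.op L'} {F : OmegaFunctor L'.op L}
    (hG : IsNaturalLifting B φ G) (hF : IsNaturalLifting B φ.symm F) :
    IsStrictDualAdjunction G F := by
  obtain ⟨i, hin, hi⟩ := hG
  obtain ⟨j, hjn, hj⟩ := hF
  obtain ⟨l, hl⟩ := (hi.liftsEvaluationCones hB hL' hA₁).exists_isEvaluationLift hL'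
  obtain ⟨k, hk⟩ := (hj.liftsEvaluationCones hB hL hB₁).exists_isEvaluationLift hL
  obtain ⟨θ, hθ⟩ := hi.exists_isTranspose hB hL' hA₁ hk
  obtain ⟨θ', hθ'⟩ := hj.exists_isTranspose hB hL hB₁ (φ := φ.symm) (j := i) (k := l) hl
  refine ⟨fun A C => ⟨θ A C, θ' C A,
    OmegaFunctor.ext fun h => hθ.transpose_transpose hL hL' hl hk hθ' h,
    OmegaFunctor.ext fun h => hθ'.transpose_transpose (φ := φ.symm) hL' hL hk hl hθ h⟩, ?_⟩
  intro A A' C C' x y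
  have key : ∀ (x : (L.Hom A' A).Cell) (y : (L'.Hom C' C).Cell) (h : (L.Hom A (cobj F C)).Cell),
      (θ A' C').map (L.homComp (L.homComp (cmap F y) h) x) =
        L'.homComp (L'.homComp (cmap G x) ((θ A C).map h)) y := fun x y h => by
    refine hL'.2 _ _ ?_
    change L'.post B₀ _ = L'.post B₀ _
    rw [hθ, post_homComp, post_homComp, hθ, pre_homComp, pre_homComp]
    simp only [Transfor.hcomp_assoc]
    rw [hk.hcomp_ofFunctor hL hjn]
    rw [← OmegaIso.symm_hcomp_hcomp (i A') ((L'.post B₀ (cmap G x)).hcomp _),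
      ← Transfor.hcomp_assoc (i A').arr, hin, Transfor.hcomp_assoc, OmegaIso.hcomp_symm_hcomp]
  refine ext_act ?_ ?_ ?_ <;>
    simp [OmegaIso.arr, s_hcomp, t_hcomp, s_pre, t_pre, s_post, t_post, ← cmap_s, ← cmap_t, key]

end Duality

theorem proposition6p1p1 (B : SubOmegaCat infCAT.{u}) (hB : B.IsFull)
    (L L' : OmegaCat.{u}) (A₀ A₁ : L.Obj) (B₀ B₁ : L'.Obj)
    (hL : IsConcreteOver B L A₀) (hL' : IsConcreteOver B L' B₀)
    (hA₁ : HomFunctorInto B L A₁) (hB₁ : HomFunctorInto B L' B₁)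
    (φ : OmegaIso (L.Hom A₀ A₁) (L'.Hom B₀ B₁)) :
    (InitialLiftingCondition B φ → InitialLiftingCondition B φ.symm →
      ∃ (G : OmegaFunctor L.op L') (F : OmegaFunctor L'.op L),
        IsStrictDualAdjunction G F ∧ IsNaturalLifting B φ G ∧ IsNaturalLifting B φ.symm F) ∧
    ∀ (G : OmegaFunctor L.op L') (F : OmegaFunctor L'.op L),
      IsNaturalLifting B φ G → IsNaturalLifting B φ.symm F → IsStrictDualAdjunction G F := by
  have adj : ∀ (G : OmegaFunctor L.op L') (F : OmegaFunctor L'.op L),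
      IsNaturalLifting B φ G → IsNaturalLifting B φ.symm F → IsStrictDualAdjunction G F :=
    fun G F hG hF => isStrictDualAdjunction_of_isNaturalLifting hB hL hL' hA₁ hB₁ hG hF
  refine ⟨fun h h' => ?_, adj⟩
  obtain ⟨G, hG⟩ := h.exists_isNaturalLifting hB hL' hA₁
  obtain ⟨F, hF⟩ := h'.exists_isNaturalLifting hB hL hB₁
  exact ⟨G, F, adj G F hG hF, hG, hF⟩
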